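/- Let $K$ be a field, let $S=K[x_1,\dots,x_m,y_1,\dots,y_n]$ be the standard bigraded polynomial ring ($\deg x_i=(1,0)$, $\deg y_j=(0,1)$), and let $Q=(y_1,\dots,y_n)$. For an $S$-module $N$ write $\operatorname{cd}(Q,N)$ for the largest integer $i$ with $H^i_Q(N)\neq 0$ (local cohomology with support in $Q$). Call $N$ relative Cohen--Macaulay with respect to $Q$ if there is an integer $q$ with $H^i_Q(N)=0$ for all $i\ne q$, and relatively unmixed with respect to $Q$ if $\operatorname{cd}(Q,N)=\operatorname{cd}(Q,S/\mathfrak p)$ for all $\mathfrak p\in\operatorname{Ass}(N)$. Let $M$ be a finitely generated bigraded $S$-module with a Cohen--Macaulay filtration with respect to $Q$, that is, a finite chain $0=M_0\subsetneq M_1\subsetneq\dots\subsetneq M_r=M$ of bigraded submodules such that every quotient $M_i/M_{i-1}$ is relative Cohen--Macaulay with respect to $Q$ and $$0\le \operatorname{cd}(Q,M_1/M_0)<\operatorname{cd}(Q,M_2/M_1)<\dots<\operatorname{cd}(Q,M_r/M_{r-1}).$$ Then for every $i=1,\dots,r$ $$\operatorname{Ass}(M_i/M_{i-1})=\{\mathfrak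 p\in\operatorname{Ass}(M_i):\ \operatorname{cd}(Q,S/\mathfrak p)=\operatorname{cd}(Q,M_i)\}.$$ In particular, for every $i=1,\dots,r$, $\operatorname{Ass}(M_i/M_{i-1})=\operatorname{Ass}(M_i)$ if and only if $M_i$ is relatively unmixed with respect to $Q$. -/

import Mathlib

universe u

noncomputable section

/-- The cohomological dimension of `M` with respect to the ideal `I`: the largest `i` for which
the local cohomology module `H^i_I(M)` is nonzero. It is a supremum in `WithBot ℕ∞`, so that it is
`⊥` if all local cohomology modules vanish. -/
def cohDim {R : Type u} [CommRing R] (I : Ideal R) (M : Type u) [AddCommGroup M] [Module R M] :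
    WithBot ℕ∞ :=
  ⨆ (i : ℕ) (_ : Nontrivial ((localCohomology I i).obj (ModuleCat.of R M))), ((i : ℕ∞) : WithBot ℕ∞)

/-- `M` is relative Cohen-Macaulay with respect to `I`: there is at most one degree `q` in which
the local cohomology of `M` with support in `I` does not vanish. -/
def IsRelCohenMacaulay {R : Type u} [CommRing R] (I : Ideal R)
    (M : Type u) [AddCommGroup M] [Module R M] : Prop :=
  ∃ q : ℤ, ∀ i : ℕ, (i : ℤ) ≠ q →
    Subsingleton ((localCohomology I i).obj (ModuleCat.of R M))

/-- `M` is relatively unmixed with respect to `I`. -/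
def IsRelUnmixed {R : Type u} [CommRing R] (I : Ideal R)
    (M : Type u) [AddCommGroup M] [Module R M] : Prop :=
  ∀ p ∈ associatedPrimes R M, cohDim I M = cohDim I (R ⧸ p)

/-- The polynomial ring `K[x_1, …, x_m, y_1, …, y_n]`. -/
abbrev BigradedPoly (K : Type u) [Field K] (m n : ℕ) : Type u :=
  MvPolynomial (Fin m ⊕ Fin n) K

/-- The standard bidegrees of the variables: `deg x_i = (1, 0)` and `deg y_j = (0, 1)`. -/
def varBidegree (m n : ℕ) : Fin m ⊕ Fin n → ℤ × ℤ :=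
  Sum.elim (fun _ => (1, 0)) (fun _ => (0, 1))

/-- The standard bigrading of the polynomial ring. -/
def polyBigrading (K : Type u) [Field K] (m n : ℕ) :
    ℤ × ℤ → Submodule K (BigradedPoly K m n) :=
  MvPolynomial.weightedHomogeneousSubmodule K (varBidegree m n)

/-- The bigraded irrelevant ideal `Q = (y_1, …, y_n)`. -/
def irrelevantQ (K : Type u) [Field K] (m n : ℕ) : Ideal (BigradedPoly K m n) :=
  Ideal.span (Set.range fun j : Fin n => MvPolynomial.X (Sum.inr j))

/-- The subquotient `F_{i+1} / F_i` of a finite chain of submodules. -/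
abbrev FiltQuot {R : Type u} [CommRing R] {M : Type u} [AddCommGroup M] [Module R M] {r : ℕ}
    (F : Fin (r + 1) → Submodule R M) (i : Fin r) : Type u :=
  F i.succ ⧸ (F i.castSucc).submoduleOf (F i.succ)

/-- `0 = F_0 ⊊ F_1 ⊊ ⋯ ⊊ F_r = M` is a Cohen-Macaulay filtration with respect to `Q` of the
module `M` over `K[x_1, …, x_m, y_1, …, y_n]`, which is bigraded by `ℳ`. -/
structure IsCohenMacaulayFiltration {K : Type u} [Field K] {m n : ℕ}
    {M : Type u} [AddCommGroup M] [Module (BigradedPoly K m n) M]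
    (ℳ : ℤ × ℤ → AddSubgroup M) [DirectSum.Decomposition ℳ] {r : ℕ}
    (F : Fin (r + 1) → Submodule (BigradedPoly K m n) M) : Prop where
  zero_eq_bot : F 0 = ⊥
  last_eq_top : F (Fin.last r) = ⊤
  strictMono : StrictMono F
  isHomogeneous : ∀ i, (F i).IsHomogeneous ℳ
  isRelCohenMacaulay : ∀ i : Fin r, IsRelCohenMacaulay (irrelevantQ K m n) (FiltQuot F i)
  cohDim_nonneg : ∀ i : Fin r, 0 ≤ cohDim (irrelevantQ K m n) (FiltQuot F i)
  cohDim_strictMono : StrictMono fun i : Fin r => cohDim (irrelevantQ K m n) (FiltQuot F i)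

end

/-! Write `q i` for the single degree in which M_i/M_{i-1} has cohomology. Long exact sequences give
H^l_Q(M_{i-1}) = 0 for l ≥ `q i`, hence cd(M_i) = `q i`. Two facts then settle both inclusions.

(a) cd is monotone in the support: a prime containing the annihilator of a finite N has cd(S/p) ≤
cd(N). So a prime with cd(S/p) ≥ `q i` does not contain ann(M_{i-1}); away from such annihilators
Ass(M_i) and Ass(M_i/M_{i-1}) agree. This is `LocCohomVanishes.quotient_prime`.

(b) If N is a bigraded subquotient with H^j_Q(N) = 0 for j < q, every p in Ass(N) has cd(S/p) ≥ q.
Otherwise take f : S/p → N injective. Dimension shifting through products of localizations shows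
that f induces zero on Ext(B, -) for every B killed by a power of Q
(`ext_comp_eq_zero_of_vanishes`). For B = S/(y_1^k, …, y_n^k) the top Ext is N/(y_1^k, …, y_n^k)N,
so f(1) lies in every Q^k N. Krull's theorem gives r in Q with (1 - r)f(1) = 0, and since r raises
the y-degree while each element has y-degrees bounded below, f(1) = 0.

All local cohomology enters through its vanishing, expressed by Ext classes dying under restriction
to higher powers of the ideal (`localCohomologyVanishes_iff`). -/

noncomputable section

open CategoryTheory Limits Opposite

/-! ### Cocycles for derived-functor Ext and for `Abelian.Ext` -/

namespace CategoryTheory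
section
variable {R : Type u} [CommRing R]

/-- The cochain map `Hom(L, Y) ⟶ Hom(K, Y)` induced by a chain map `K ⟶ L`. -/
def linearYonedaObjMap {K L : ChainComplex (ModuleCat.{u} R) ℕ} (φ : K ⟶ L)
    (Y : ModuleCat.{u} R) : L.linearYonedaObj R Y ⟶ K.linearYonedaObj R Y :=
  (HomologicalComplex.unopFunctor _ _).map
    (((((linearYoneda R (ModuleCat.{u} R)).obj Y).rightOp.mapHomologicalComplex _).map φ).op)

/-- `Ext` is a left derived functor of Hom(-, Y) into the opposite category, so naturality is that
of `isoLeftDerivedObj` read through `unop`, combined with homology commuting with `op`. -/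
theorem ProjectiveResolution.isoExt_inv_naturality {X X' : ModuleCat.{u} R} (g : X' ⟶ X)
    (P' : ProjectiveResolution X') (P : ProjectiveResolution X) (φ : P'.complex ⟶ P.complex)
    (comm : φ.f 0 ≫ P.π.f 0 = P'.π.f 0 ≫ g) (n : ℕ) (Y : ModuleCat.{u} R) :
    (P.isoExt (R := R) n Y).inv ≫ ((Ext R (ModuleCat.{u} R) n).map g.op).app Y =
      HomologicalComplex.homologyMap (linearYonedaObjMap φ Y) n ≫
        (P'.isoExt (R := R) n Y).inv := by
  let F := ((linearYoneda R (ModuleCat.{u} R)).obj Y).rightOp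
  have h₂ : (P.isoLeftDerivedObj F n).hom.unop ≫ ((F.leftDerived n).map g).unop =
      (HomologicalComplex.homologyMap ((F.mapHomologicalComplex _).map φ) n).unop ≫
        (P'.isoLeftDerivedObj F n).hom.unop :=
    congrArg Quiver.Hom.unop
      (ProjectiveResolution.isoLeftDerivedObj_hom_naturality g P' P φ comm F n)
  have h₃ : (HomologicalComplex.homologyUnop ((F.mapHomologicalComplex _).obj P.complex) n).hom ≫
        (HomologicalComplex.homologyMap ((F.mapHomologicalComplex _).map φ) n).unop =
      HomologicalComplex.homologyMap (linearYonedaObjMap φ Y) n ≫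
        (HomologicalComplex.homologyUnop ((F.mapHomologicalComplex _).obj P'.complex) n).hom :=
    congrArg Quiver.Hom.unop
      (HomologicalComplex.homologyOp_hom_naturality (linearYonedaObjMap φ Y) n)
  exact (Category.assoc _ _ _).trans ((congrArg (fun z => _ ≫ z) h₂).trans
    ((Category.assoc _ _ _).symm.trans
      ((congrArg (fun z => z ≫ (P'.isoLeftDerivedObj F n).hom.unop) h₃).trans
        (Category.assoc _ _ _))))

/-- The element `x` of the derived functor `Ext` is the class of the cocycle `f`. -/
def ProjectiveResolution.Represents {X : ModuleCat.{u} R} (P : ProjectiveResolution X) {n : ℕ}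
    {Y : ModuleCat.{u} R} (f : P.complex.X n ⟶ Y)
    (x : ((Ext R (ModuleCat.{u} R) n).obj (op X)).obj Y) : Prop :=
  ∃ z : (P.complex.linearYonedaObj R Y).cycles n,
    ((P.complex.linearYonedaObj R Y).iCycles n).hom z = f ∧
    (P.isoExt (R := R) n Y).inv.hom (((P.complex.linearYonedaObj R Y).homologyπ n).hom z) = x

namespace ProjectiveResolution

variable {X : ModuleCat.{u} R} (P : ProjectiveResolution X) {n : ℕ} {Y : ModuleCat.{u} R}

theorem exists_represents_of_cocycle (f : P.complex.X n ⟶ Y)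
    (hf : P.complex.d (n + 1) n ≫ f = 0) : ∃ x, P.Represents (R := R) f x := by
  let K := P.complex.linearYonedaObj R Y
  have h := ShortComplex.exact_of_f_is_kernel (ShortComplex.mk (K.iCycles n) (K.d n (n + 1))
    (by simp)) (K.cyclesIsKernel n (n + 1) (by simp))
  rw [ShortComplex.moduleCat_exact_iff] at h
  obtain ⟨z, hz⟩ := h f hf
  exact ⟨_, z, hz, rfl⟩

theorem exists_cocycle_represents (x : ((Ext R (ModuleCat.{u} R) n).obj (op X)).obj Y) :
    ∃ f : P.complex.X n ⟶ Y, P.complex.d (n + 1) n ≫ f = 0 ∧ P.Represents (R := R) f x := by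
  let K := P.complex.linearYonedaObj R Y
  obtain ⟨z, hz⟩ := (ModuleCat.epi_iff_surjective (K.homologyπ n)).1 inferInstance
    ((P.isoExt (R := R) n Y).hom.hom x)
  refine ⟨(K.iCycles n).hom z, ?_, z, rfl, ?_⟩
  · change (K.d n (n + 1)).hom ((K.iCycles n).hom z) = 0
    rw [← LinearMap.comp_apply, ← ModuleCat.hom_comp, K.iCycles_d]
    rfl
  · erw [hz]
    rw [← LinearMap.comp_apply, ← ModuleCat.hom_comp, Iso.hom_inv_id]
    rfl

/-- Using `prev n` covers degree 0 too: there `prev 0 = 0` and the differential is zero, so only `f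
= 0` is a coboundary. -/
theorem Represents.eq_zero_iff {P : ProjectiveResolution X} {f : P.complex.X n ⟶ Y}
    {x : ((Ext R (ModuleCat.{u} R) n).obj (op X)).obj Y} (h : P.Represents f x) :
    x = 0 ↔ ∃ g : P.complex.X ((ComplexShape.up ℕ).prev n) ⟶ Y,
      P.complex.d n ((ComplexShape.up ℕ).prev n) ≫ g = f := by
  let K := P.complex.linearYonedaObj R Y
  have hE := ShortComplex.exact_of_g_is_cokernel (ShortComplex.mk
    (K.toCycles ((ComplexShape.up ℕ).prev n) n) (K.homologyπ n)
    (by simp)) (K.homologyIsCokernel _ n rfl)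
  rw [ShortComplex.moduleCat_exact_iff] at hE
  have hi := (ModuleCat.mono_iff_injective (K.iCycles n)).1 inferInstance
  have ht (g) : (K.iCycles n).hom ((K.toCycles ((ComplexShape.up ℕ).prev n) n).hom g) =
      (K.d ((ComplexShape.up ℕ).prev n) n).hom g := by
    rw [← LinearMap.comp_apply, ← ModuleCat.hom_comp, K.toCycles_i]
  have hπ (g) : (K.homologyπ n).hom
      ((K.toCycles ((ComplexShape.up ℕ).prev n) n).hom g) = 0 := by
    rw [← LinearMap.comp_apply, ← ModuleCat.hom_comp, K.toCycles_comp_homologyπ]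
    rfl
  obtain ⟨z, rfl, rfl⟩ := h
  have hinv := (ModuleCat.mono_iff_injective (P.isoExt (R := R) n Y).inv).1 inferInstance
  refine ⟨fun h0 => ?_, fun ⟨g, hg⟩ => ?_⟩
  · obtain ⟨g, hg⟩ := hE z (hinv (h0.trans (map_zero _).symm))
    exact ⟨g, by rw [← hg]; exact (ht g).symm⟩
  · have : (K.toCycles ((ComplexShape.up ℕ).prev n) n).hom g = z := hi ((ht g).trans hg)
    have hp : (K.homologyπ n).hom z = 0 := this ▸ hπ g
    exact (congrArg _ hp).trans (map_zero _)

theorem Represents.precomp {X' : ModuleCat.{u} R} {P' : ProjectiveResolution X'} {g : X' ⟶ X}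
    {P : ProjectiveResolution X} {f : P.complex.X n ⟶ Y}
    {x : ((Ext R (ModuleCat.{u} R) n).obj (op X)).obj Y} (h : P.Represents f x)
    (φ : Hom P' P g) :
    P'.Represents (R := R) (φ.hom.f n ≫ f)
      ((((Ext R (ModuleCat.{u} R) n).map g.op).app Y).hom x) := by
  obtain ⟨z, rfl, rfl⟩ := h
  refine ⟨(HomologicalComplex.cyclesMap (linearYonedaObjMap φ.hom Y) n).hom z, ?_, ?_⟩
  · rw [← LinearMap.comp_apply, ← ModuleCat.hom_comp, HomologicalComplex.cyclesMap_i]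
    rfl
  · have h1 := congrArg (fun t => t.hom (((P.complex.linearYonedaObj R Y).homologyπ n).hom z))
      (isoExt_inv_naturality g P' P φ.hom (by simpa using φ.hom_f_zero_comp_π_f_zero) n Y)
    refine Eq.trans ?_ h1.symm
    have h2 := congrArg (fun t => t.hom z)
      (HomologicalComplex.homologyπ_naturality (linearYonedaObjMap φ.hom Y) n)
    exact congrArg _ h2.symm

end ProjectiveResolution

end
end CategoryTheory

namespace CategoryTheory.ProjectiveResolution

theorem extMk_eq_zero_iff_prev {C : Type*} [Category* C] [Abelian C] [HasExt C] {X Y : C}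
    (P : ProjectiveResolution X) {n : ℕ} (f : P.complex.X n ⟶ Y)
    (hf : P.complex.d (n + 1) n ≫ f = 0) :
    P.extMk f (n + 1) rfl hf = 0 ↔ ∃ g : P.complex.X ((ComplexShape.up ℕ).prev n) ⟶ Y,
      P.complex.d n ((ComplexShape.up ℕ).prev n) ≫ g = f := by
  cases n with
  | succ n => rw [P.extMk_eq_zero_iff f _ rfl hf ((ComplexShape.up ℕ).prev (n + 1)) (by simp)]
  | zero =>
    have h0 : (ComplexShape.up ℕ).prev 0 = 0 := by simp
    have hd : P.complex.d 0 ((ComplexShape.up ℕ).prev 0) = 0 :=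
      P.complex.shape _ _ (by simp [h0])
    rw [hd]
    simp only [zero_comp, exists_const_iff]
    refine ⟨fun h => ⟨⟨0⟩, ?_⟩, fun ⟨_, h⟩ => by subst h; simp⟩
    simp only [← P.extEquivCohomologyClass.apply_eq_iff_eq,
      extEquivCohomologyClass_extMk, extEquivCohomologyClass_zero,
      CochainComplex.HomComplex.CohomologyClass.mk_eq_zero_iff] at h
    rw [CochainComplex.HomComplex.Cocycle.toSingleMk_mem_coboundaries_iff _ _ _ _ _ 1
      (by simp)] at h
    obtain ⟨g, hg⟩ := h
    -- The resolution sits in degrees ≤ 0, so a coboundary in degree 0 factors through a zero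
    -- object.
    have hz : P.cochainComplex.d (-(0 : ℕ)) 1 = 0 :=
      (P.cochainComplex.isZero_of_isStrictlyLE 0 1 (by simp)).eq_of_tgt _ _
    rw [hz, zero_comp] at hg
    rw [← cancel_epi (P.cochainComplexXIso (-(0 : ℕ)) 0 rfl).hom, ← hg, comp_zero]

end CategoryTheory.ProjectiveResolution

/-! ### Vanishing of local cohomology in terms of Ext classes -/

section
variable {R : Type u} [CommRing R]

/-- The projection `R ⧸ J' ⟶ R ⧸ J` for `J' ≤ J`. -/
def Ideal.quotientProj {J' J : Ideal R} (h : J' ≤ J) :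
    ModuleCat.of R (R ⧸ J') ⟶ ModuleCat.of R (R ⧸ J) :=
  ModuleCat.ofHom (Submodule.mapQ J' J LinearMap.id h)

/-- Every class in `Ext^i(R/I^k, M)` dies in `Ext^i(R/I^k', M)` for some `k' ≥ k`. -/
def LocalCohomologyVanishes (I : Ideal R) (i : ℕ) (M : ModuleCat.{u} R) : Prop :=
  ∀ (k : ℕ) (x : Abelian.Ext (ModuleCat.of R (R ⧸ I ^ k)) M i), ∃ (k' : ℕ) (h : k ≤ k'),
    (Abelian.Ext.mk₀ (Ideal.quotientProj (Ideal.pow_le_pow_right (I := I) h))).comp x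
      (zero_add i) = 0

/-- Both sides say that the same cocycle, `f` pulled back to a resolution of `X'`, is a coboundary.
Comparing zero classes this way avoids building an isomorphism between the two versions of Ext. -/
theorem CategoryTheory.ProjectiveResolution.Represents.map_eq_zero_iff {X Y : ModuleCat.{u} R}
    {P : ProjectiveResolution X} {i : ℕ} {f : P.complex.X i ⟶ Y}
    {hf : P.complex.d (i + 1) i ≫ f = 0} {x : ((Ext R (ModuleCat.{u} R) i).obj (op X)).obj Y}
    (hx : P.Represents f x) {X' : ModuleCat.{u} R} (g : X' ⟶ X) :
    (((Ext R (ModuleCat.{u} R) i).map g.op).app Y).hom x = 0 ↔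
      (Abelian.Ext.mk₀ g).comp (P.extMk f (i + 1) rfl hf) (zero_add i) = 0 := by
  let P' := projectiveResolution X'
  let φ : ProjectiveResolution.Hom P' P g :=
    ⟨ProjectiveResolution.lift g P' P,
      (ProjectiveResolution.lift_commutes_zero g P' P).trans (by simp)⟩
  rw [(hx.precomp φ).eq_zero_iff, ProjectiveResolution.mk₀_comp_extMk f _ rfl hf φ,
    ProjectiveResolution.extMk_eq_zero_iff_prev]

/-- A filtered colimit of modules is zero exactly when every element dies at a later stage. -/
theorem localCohomologyVanishes_iff (I : Ideal R) (i : ℕ) (M : ModuleCat.{u} R) :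
    Subsingleton ((localCohomology I i).obj M) ↔ LocalCohomologyVanishes I i M := by
  let D := localCohomology.diagram (localCohomology.idealPowersDiagram I) i
  let F : (ℕᵒᵖ)ᵒᵖ ⥤ ModuleCat.{u} R := D ⋙ (evaluation _ _).obj M
  let e : (localCohomology I i).obj M ≅ colimit F := colimitObjIsoColimitCompEvaluation D M
  have : PreservesFilteredColimitsOfSize.{0, 0} (forget (ModuleCat.{u} R)) :=
    preservesFilteredColimitsOfSize_shrink.{0, u, 0, u} _
  have key : Subsingleton (colimit F : ModuleCat.{u} R) ↔
      ∀ (k : ℕ) (x : F.obj (op (op k))), ∃ (k' : ℕ) (h : k ≤ k'),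
        (F.map (homOfLE h).op.op).hom x = 0 := by
    constructor
    · intro h k x
      obtain ⟨j, f, hf⟩ := Concrete.colimit_rep_eq_zero R F (op (op k)) x (Subsingleton.elim _ _)
      exact ⟨j.unop.unop, f.unop.unop.le, hf⟩
    · intro h
      refine subsingleton_of_forall_eq 0 fun y => ?_
      obtain ⟨j, x, rfl⟩ := Concrete.colimit_exists_rep F y
      obtain ⟨k', h, hx⟩ := h j.unop.unop x
      have := colimit.w F (homOfLE h).op.op
      erw [← this]
      rw [ConcreteCategory.comp_apply]
      erw [hx]
      simp
  have hs : Subsingleton ((localCohomology I i).obj M) ↔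
      Subsingleton (colimit F : ModuleCat.{u} R) := e.toLinearEquiv.toEquiv.subsingleton_congr
  rw [hs, key]
  constructor
  · intro h k y
    let P := projectiveResolution (ModuleCat.of R (R ⧸ I ^ k))
    obtain ⟨f, hf, rfl⟩ := P.extMk_surjective y (i + 1) rfl
    obtain ⟨x, hx⟩ := P.exists_represents_of_cocycle f hf
    obtain ⟨k', h, hk⟩ := h k x
    exact ⟨k', h, (hx.map_eq_zero_iff _).1 hk⟩
  · intro h k x
    let P := projectiveResolution (ModuleCat.of R (R ⧸ I ^ k))
    obtain ⟨f, hf, hx⟩ := P.exists_cocycle_represents x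
    obtain ⟨k', h, hk⟩ := h k (P.extMk f (i + 1) rfl hf)
    exact ⟨k', h, (hx.map_eq_zero_iff _).2 hk⟩
end

/-! ### Restriction of classes and long exact sequences -/

section
variable {R : Type u} [CommRing R]

/-- Restriction of classes along `R ⧸ J' ⟶ R ⧸ J`. -/
def extRestrict {J' J : Ideal R} (h : J' ≤ J) {M : ModuleCat.{u} R} {i : ℕ}
    (x : Abelian.Ext (ModuleCat.of R (R ⧸ J)) M i) : Abelian.Ext (ModuleCat.of R (R ⧸ J')) M i :=
  (Abelian.Ext.mk₀ (Ideal.quotientProj h)).comp x (zero_add i)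

theorem Ideal.quotientProj_comp {J'' J' J : Ideal R} (h' : J'' ≤ J') (h : J' ≤ J) :
    Ideal.quotientProj h' ≫ Ideal.quotientProj h = Ideal.quotientProj (h'.trans h) := by
  ext
  rfl

theorem extRestrict_extRestrict {J'' J' J : Ideal R} (h' : J'' ≤ J') (h : J' ≤ J)
    {M : ModuleCat.{u} R} {i : ℕ} (x : Abelian.Ext (ModuleCat.of R (R ⧸ J)) M i) :
    extRestrict h' (extRestrict h x) = extRestrict (h'.trans h) x := by
  simp [extRestrict, Ideal.quotientProj_comp]

theorem extRestrict_comp {J' J : Ideal R} (h : J' ≤ J) {M N : ModuleCat.{u} R} {i j k : ℕ}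
    (x : Abelian.Ext (ModuleCat.of R (R ⧸ J)) M i) (y : Abelian.Ext M N j) (hk : i + j = k) :
    extRestrict h (x.comp y hk) = (extRestrict h x).comp y hk := by
  simp only [extRestrict]
  rw [Abelian.Ext.comp_assoc _ _ _ (zero_add i) hk (by lia)]

@[simp]
theorem extRestrict_zero {J' J : Ideal R} (h : J' ≤ J) {M : ModuleCat.{u} R} {i : ℕ} :
    extRestrict h (0 : Abelian.Ext (ModuleCat.of R (R ⧸ J)) M i) = 0 := by
  simp [extRestrict]

namespace LocalCohomologyVanishes

variable {I : Ideal R} {i : ℕ}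

section ShortExact

variable {S : ShortComplex (ModuleCat.{u} R)} (hS : S.ShortExact)
include hS

/-- Restrict until the image in `S.X₃` dies, lift the class to `S.X₁`, then restrict again. -/
theorem of_shortExact₂ (h₁ : LocalCohomologyVanishes I i S.X₁)
    (h₃ : LocalCohomologyVanishes I i S.X₃) : LocalCohomologyVanishes I i S.X₂ := by
  intro k x
  obtain ⟨k₁, hk₁, hx₁⟩ := h₃ k (x.comp (Abelian.Ext.mk₀ S.g) (add_zero i))
  change extRestrict _ _ = 0 at hx₁
  rw [extRestrict_comp] at hx₁
  obtain ⟨y, hy⟩ := Abelian.Ext.covariant_sequence_exact₂ _ hS _ hx₁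
  obtain ⟨k₂, hk₂, hx₂⟩ := h₁ k₁ y
  change extRestrict _ _ = 0 at hx₂
  refine ⟨k₂, hk₁.trans hk₂, ?_⟩
  change extRestrict _ _ = 0
  rw [← extRestrict_extRestrict (Ideal.pow_le_pow_right hk₂) (Ideal.pow_le_pow_right hk₁), ← hy,
    extRestrict_comp, hx₂, Abelian.Ext.zero_comp]

theorem of_shortExact₃ (h₂ : LocalCohomologyVanishes I i S.X₂)
    (h₁ : LocalCohomologyVanishes I (i + 1) S.X₁) : LocalCohomologyVanishes I i S.X₃ := by
  intro k x
  obtain ⟨k₁, hk₁, hx₁⟩ := h₁ k (x.comp hS.extClass rfl)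
  change extRestrict _ _ = 0 at hx₁
  rw [extRestrict_comp] at hx₁
  obtain ⟨y, hy⟩ := Abelian.Ext.covariant_sequence_exact₃ _ hS _ _ hx₁
  obtain ⟨k₂, hk₂, hx₂⟩ := h₂ k₁ y
  change extRestrict _ _ = 0 at hx₂
  refine ⟨k₂, hk₁.trans hk₂, ?_⟩
  change extRestrict _ _ = 0
  rw [← extRestrict_extRestrict (Ideal.pow_le_pow_right hk₂) (Ideal.pow_le_pow_right hk₁), ← hy,
    extRestrict_comp, hx₂, Abelian.Ext.zero_comp]

end ShortExact

theorem of_iso {M N : ModuleCat.{u} R} (e : M ≅ N) (h : LocalCohomologyVanishes I i M) :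
    LocalCohomologyVanishes I i N := by
  intro k x
  obtain ⟨k₁, hk₁, hx₁⟩ := h k (x.comp (Abelian.Ext.mk₀ e.inv) (add_zero _))
  refine ⟨k₁, hk₁, ?_⟩
  change extRestrict _ _ = 0 at hx₁
  change extRestrict _ _ = 0
  rw [extRestrict_comp] at hx₁
  have := congrArg (fun t => Abelian.Ext.comp t (Abelian.Ext.mk₀ e.hom) (add_zero i)) hx₁
  simpa using this

theorem of_subsingleton (M : ModuleCat.{u} R) [Subsingleton M] :
    LocalCohomologyVanishes I i M := fun k x =>
  ⟨k, le_rfl, by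
    have h : (𝟙 M : M ⟶ M) = 0 := by ext m; exact Subsingleton.elim _ _
    have : x = 0 := by
      rw [← Abelian.Ext.comp_mk₀_id x, h, Abelian.Ext.mk₀_zero, Abelian.Ext.comp_zero]
    rw [this, Abelian.Ext.comp_zero]⟩

/-- If `H^0_I(M) = 0`, then `M` has no nonzero element killed by a power of `I`. -/
theorem eq_zero_of_pow_smul {M : ModuleCat.{u} R} (h : LocalCohomologyVanishes I 0 M)
    {m : M} {k : ℕ} (hm : ∀ r ∈ I ^ k, r • m = 0) : m = 0 := by
  let g : ModuleCat.of R (R ⧸ I ^ k) ⟶ M :=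
    ModuleCat.ofHom ((I ^ k).liftQ (LinearMap.toSpanSingleton R M m) (fun r hr => hm r hr))
  obtain ⟨k', hk, h0⟩ := h k (Abelian.Ext.mk₀ g)
  rw [Abelian.Ext.mk₀_comp_mk₀, Abelian.Ext.mk₀_eq_zero_iff] at h0
  have := congrArg (fun t => t.hom (Ideal.Quotient.mk _ 1)) h0
  change (1 : R) • m = 0 at this
  simpa using this

end LocalCohomologyVanishes

/-- `Ext^j(B, E) = 0` if some `r` kills `B` and acts bijectively on `E`. -/
theorem ext_eq_zero_of_bijective_smul {B E : ModuleCat.{u} R} {r : R} (hB : ∀ b : B, r • b = 0)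
    (hE : Function.Bijective fun x : E => r • x) {j : ℕ} (x : Abelian.Ext B E j) : x = 0 := by
  have h0 : r • x = 0 := by
    have h : r • 𝟙 B = 0 := by ext b; exact hB b
    have : r • x = (Abelian.Ext.mk₀ (r • 𝟙 B)).comp x (zero_add j) := by
      simp [Abelian.Ext.mk₀_smul]
    rw [this, h, Abelian.Ext.mk₀_zero, Abelian.Ext.zero_comp]
  let e : E ≅ E := (LinearEquiv.ofBijective (LinearMap.lsmul R E r) hE).toModuleIso
  have he : e.hom = r • 𝟙 E := by ext; rfl
  have h1 : x.comp (Abelian.Ext.mk₀ e.hom) (add_zero j) = 0 := by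
    rw [he]; simpa [Abelian.Ext.mk₀_smul] using h0
  have := congrArg (fun t => Abelian.Ext.comp t (Abelian.Ext.mk₀ e.inv) (add_zero j)) h1
  simpa using this

end

/-! ### Torsion modules have no higher local cohomology -/

section
variable {R : Type u} [CommRing R]

/-- The `R`-module `M` is `I`-power torsion. -/
def IsIdealPowTorsion (I : Ideal R) (M : Type u) [AddCommGroup M] [Module R M] : Prop :=
  ∀ m : M, ∃ k : ℕ, ∀ r ∈ I ^ k, r • m = 0

theorem IsIdealPowTorsion.exists_pow_smul_eq_zero {I : Ideal R} {T : Type u} [AddCommGroup T]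
    [Module R T] (hT : IsIdealPowTorsion I T) {N : Submodule R T} (hN : N.FG) :
    ∃ k : ℕ, ∀ r ∈ I ^ k, ∀ m ∈ N, r • m = 0 := by
  induction N, hN using Submodule.fg_induction with
  | singleton m =>
    obtain ⟨k, hk⟩ := hT m
    refine ⟨k, fun r hr x hx => ?_⟩
    obtain ⟨a, rfl⟩ := Submodule.mem_span_singleton.1 hx
    rw [smul_comm, hk r hr, smul_zero]
  | sup N₁ N₂ _ _ h₁ h₂ =>
    obtain ⟨k₁, h₁⟩ := h₁
    obtain ⟨k₂, h₂⟩ := h₂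
    refine ⟨k₁ + k₂, fun r hr x hx => ?_⟩
    obtain ⟨x₁, hx₁, x₂, hx₂, rfl⟩ := Submodule.mem_sup.1 hx
    rw [smul_add, h₁ r (Ideal.pow_le_pow_right (by lia) hr) _ hx₁,
      h₂ r (Ideal.pow_le_pow_right (by lia) hr) _ hx₂, add_zero]

/-- By naturality of the connecting class, restricting along `τ.τ₃` becomes restricting `z` along
`τ.τ₁`, which factors through `b`. -/
theorem extClass_comp_restrict_eq_zero {S₁ S₂ : ShortComplex (ModuleCat.{u} R)}
    (h₁ : S₁.ShortExact) (h₂ : S₂.ShortExact) (τ : S₁ ⟶ S₂)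
    {W : ModuleCat.{u} R} (a : S₁.X₁ ⟶ W) (b : W ⟶ S₂.X₁) (hab : τ.τ₁ = a ≫ b)
    {T : ModuleCat.{u} R} {i j : ℕ} (z : Abelian.Ext S₂.X₁ T i) {hj : 1 + i = j}
    (hz : (Abelian.Ext.mk₀ b).comp z (zero_add i) = 0) :
    (Abelian.Ext.mk₀ τ.τ₃).comp (h₂.extClass.comp z hj) (zero_add j) = 0 := by
  rw [← Abelian.Ext.comp_assoc _ _ _ (zero_add 1) hj (by lia),
    ← ShortComplex.ShortExact.extClass_naturality h₁ h₂ τ,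
    Abelian.Ext.comp_assoc _ _ _ (add_zero 1) (zero_add i) (by lia), hab,
    ← Abelian.Ext.mk₀_comp_mk₀_assoc, hz, Abelian.Ext.comp_zero, Abelian.Ext.comp_zero]

/-- A class in `Ext^i(M, T)`, with `M` finitely generated and `T` torsion, restricts to zero on
`I^t M` for large `t`. -/
theorem IsIdealPowTorsion.exists_restrict_eq_zero [IsNoetherianRing R] {I : Ideal R}
    {T : ModuleCat.{u} R} (hT : IsIdealPowTorsion I T) (i : ℕ) :
    ∀ (M : Type u) [AddCommGroup M] [Module R M] [Module.Finite R M]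
      (x : Abelian.Ext (ModuleCat.of R M) T i), ∃ t : ℕ,
      (Abelian.Ext.mk₀ (ModuleCat.ofHom (I ^ t • ⊤ : Submodule R M).subtype)).comp x
        (zero_add i) = 0 := by
  induction i with
  | zero =>
    intro M _ _ _ x
    obtain ⟨φ, rfl⟩ := Abelian.Ext.addEquiv₀.symm.surjective x
    obtain ⟨k, hk⟩ := hT.exists_pow_smul_eq_zero
      (N := LinearMap.range φ.hom) (Module.Finite.fg_top.map φ.hom |> fun h => by
        rwa [Submodule.map_top] at h)
    refine ⟨k, ?_⟩
    rw [Abelian.Ext.addEquiv₀_symm_apply, Abelian.Ext.mk₀_comp_mk₀, Abelian.Ext.mk₀_eq_zero_iff]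
    ext ⟨m, hm⟩
    change φ.hom m = 0
    induction hm using Submodule.smul_induction_on' with
    | smul r hr m _ => rw [map_smul, hk r hr _ (LinearMap.mem_range_self _ _)]
    | add x _ y _ hx hy => rw [map_add, hx, hy, add_zero]
  | succ i ih =>
    intro M _ _ _ x
    obtain ⟨n, p, hp⟩ := Module.Finite.exists_fin' R M
    let F : Type u := ULift.{u} (Fin n) → R
    let e : F ≃ₗ[R] (Fin n → R) := LinearEquiv.funCongrLeft R R Equiv.ulift.symm
    let q : F →ₗ[R] M := p ∘ₗ e.toLinearMap
    have hq : Function.Surjective q := hp.comp e.surjective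
    have hS := LinearMap.shortExact_shortComplexKer hq
    have : Projective (ModuleCat.of R F) := ModuleCat.projective_of_free (Pi.basisFun R _)
    obtain ⟨z, hz⟩ := Abelian.Ext.contravariant_sequence_exact₃ hS T x
      (Abelian.Ext.eq_zero_of_projective _) (add_comm 1 i)
    obtain ⟨s, hs⟩ := ih (LinearMap.ker q) z
    -- Artin–Rees: I^(c+s)F ∩ ker q lies in I^s ker q, where `z` already restricts to zero.
    obtain ⟨c, hc⟩ := I.exists_pow_inf_eq_pow_smul (LinearMap.ker q)
    refine ⟨c + s, ?_⟩
    let g : (I ^ (c + s) • ⊤ : Submodule R F) →ₗ[R] (I ^ (c + s) • ⊤ : Submodule R M) :=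
      q.restrict (fun v hv => by
        have := Submodule.mem_map_of_mem (f := q) hv
        rw [Submodule.map_smul''] at this
        exact Submodule.smul_mono le_rfl le_top this)
    have hg : Function.Surjective g := by
      rintro ⟨m, hm⟩
      rw [← LinearMap.range_eq_top.2 hq, ← Submodule.map_top, ← Submodule.map_smul''] at hm
      obtain ⟨v, hv, rfl⟩ := hm
      exact ⟨⟨v, hv⟩, rfl⟩
    have hS' := LinearMap.shortExact_shortComplexKer hg
    let κ : LinearMap.ker g →ₗ[R] (I ^ s • ⊤ : Submodule R (LinearMap.ker q)) :=
      LinearMap.codRestrict _ (LinearMap.codRestrict (LinearMap.ker q)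
        ((Submodule.subtype _).comp (LinearMap.ker g).subtype)
        (fun v => congrArg Subtype.val v.2)) (fun v => by
          have h1 : (v.1.1 : F) ∈ I ^ (c + s) • ⊤ ⊓ LinearMap.ker q :=
            ⟨v.1.2, congrArg Subtype.val v.2⟩
          rw [hc _ (by lia), Nat.add_sub_cancel_left] at h1
          have h2 : (v.1.1 : F) ∈ I ^ s • LinearMap.ker q :=
            Submodule.smul_mono le_rfl inf_le_right h1
          exact (Submodule.mem_smul_top_iff _ _ _).2 h2)
    let τ : g.shortComplexKer ⟶ q.shortComplexKer :=
      { τ₁ := ModuleCat.ofHom κ ≫ ModuleCat.ofHom (Submodule.subtype _)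
        τ₂ := ModuleCat.ofHom (Submodule.subtype _)
        τ₃ := ModuleCat.ofHom (Submodule.subtype _)
        comm₁₂ := by ext v; rfl
        comm₂₃ := by ext v; rfl }
    change (Abelian.Ext.mk₀ τ.τ₃).comp x _ = 0
    rw [← hz]
    exact extClass_comp_restrict_eq_zero hS' hS τ (ModuleCat.ofHom κ) _ rfl z hs

/-- Torsion modules have no higher local cohomology. -/
theorem IsIdealPowTorsion.localCohomologyVanishes [IsNoetherianRing R] {I : Ideal R}
    {T : ModuleCat.{u} R} (hT : IsIdealPowTorsion I T) (i : ℕ) :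
    LocalCohomologyVanishes I (i + 1) T := by
  intro k x
  let S (k : ℕ) : ShortComplex (ModuleCat.{u} R) :=
    ShortComplex.mk (ModuleCat.ofHom (I ^ k).subtype) (ModuleCat.ofHom (I ^ k).mkQ)
      (by ext r; exact (Submodule.Quotient.mk_eq_zero _).2 r.2)
  have hS (k : ℕ) : (S k).ShortExact :=
    ModuleCat.shortComplex_shortExact _
      (by
        intro r
        refine ⟨fun h => ⟨⟨r, (Submodule.Quotient.mk_eq_zero _).1 h⟩, rfl⟩, ?_⟩
        rintro ⟨r, rfl⟩
        exact (Submodule.Quotient.mk_eq_zero _).2 r.2)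
      Subtype.val_injective (Submodule.mkQ_surjective _)
  have : Projective (S k).X₂ := ModuleCat.projective_of_free (Module.Basis.singleton Unit R)
  -- As R is projective, `x` comes from a class on I^k, which dies on I^t I^k = I^(k+t).
  obtain ⟨z, hz⟩ := Abelian.Ext.contravariant_sequence_exact₃ (hS k) T x
    (Abelian.Ext.eq_zero_of_projective _) (add_comm 1 i)
  obtain ⟨t, ht⟩ := hT.exists_restrict_eq_zero i _ z
  refine ⟨k + t, by lia, ?_⟩
  let κ : ↥(I ^ (k + t)) →ₗ[R] (I ^ t • ⊤ : Submodule R ↥(I ^ k)) :=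
    LinearMap.codRestrict _ (Submodule.inclusion (Ideal.pow_le_pow_right (by lia))) (fun v =>
      (Submodule.mem_smul_top_iff _ _ _).2 (by
        rw [smul_eq_mul, ← pow_add, add_comm t k]
        exact v.2))
  let τ : S (k + t) ⟶ S k :=
    { τ₁ := ModuleCat.ofHom κ ≫ ModuleCat.ofHom (Submodule.subtype _)
      τ₂ := 𝟙 _
      τ₃ := Ideal.quotientProj (Ideal.pow_le_pow_right (by lia))
      comm₁₂ := by ext v; rfl
      comm₂₃ := by ext; rfl }
  change (Abelian.Ext.mk₀ τ.τ₃).comp x _ = 0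
  rw [← hz]
  exact extClass_comp_restrict_eq_zero (hS (k + t)) (hS k) τ (ModuleCat.ofHom κ) _ rfl z ht

end

/-! ### Products of localizations and dimension shifting -/

section
variable {R : Type u} [CommRing R] {ι : Type} (y : ι → R)

/-- The product of the localizations of `A` at the powers of the `y j`. -/
abbrev LocProd (A : Type u) [AddCommGroup A] [Module R A] : Type u :=
  ∀ j, LocalizedModule (Submonoid.powers (y j)) A

/-- The canonical map from `A` to the product of its localizations. -/
def LocProd.mk (A : Type u) [AddCommGroup A] [Module R A] : A →ₗ[R] LocProd y A :=
  LinearMap.pi fun j => LocalizedModule.mkLinearMap (Submonoid.powers (y j)) A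

/-- Functoriality of `LocProd`. -/
def LocProd.map {A N : Type u} [AddCommGroup A] [Module R A] [AddCommGroup N] [Module R N]
    (f : A →ₗ[R] N) : LocProd y A →ₗ[R] LocProd y N :=
  LinearMap.pi fun j => (IsLocalizedModule.map (Submonoid.powers (y j))
    (LocalizedModule.mkLinearMap _ _) (LocalizedModule.mkLinearMap _ _) f).comp (LinearMap.proj j)

theorem LocProd.map_mk {A N : Type u} [AddCommGroup A] [Module R A] [AddCommGroup N] [Module R N]
    (f : A →ₗ[R] N) (a : A) : LocProd.map y f (LocProd.mk y A a) = LocProd.mk y N (f a) := by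
  funext j
  exact IsLocalizedModule.map_apply (Submonoid.powers (y j)) _ _ f a

theorem LocProd.isIdealPowTorsion_ker [Finite ι] (A : Type u) [AddCommGroup A] [Module R A] :
    IsIdealPowTorsion (Ideal.span (Set.range y)) (LinearMap.ker (LocProd.mk y A)) := by
  rintro ⟨a, ha⟩
  have h : Ideal.span (Set.range y) ≤ (Ideal.torsionOf R A a).radical := by
    rw [Ideal.span_le]
    rintro _ ⟨j, rfl⟩
    have : LocalizedModule.mkLinearMap (Submonoid.powers (y j)) A a = 0 := congrFun ha j
    rw [IsLocalizedModule.eq_zero_iff (Submonoid.powers (y j))] at this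
    obtain ⟨⟨_, n, rfl⟩, hn⟩ := this
    exact ⟨n, hn⟩
  obtain ⟨n, hn⟩ := Ideal.exists_pow_le_of_le_radical_of_fg h
    (Submodule.fg_span (Set.finite_range y))
  exact ⟨n, fun r hr => Subtype.ext (hn hr)⟩

/-- On each factor `y l ^ k` is bijective while it kills `B`; the identity of the finite product is
the sum of its projections followed by inclusions. -/
theorem LocProd.ext_eq_zero [Finite ι] {A B : ModuleCat.{u} R} {k : ℕ}
    (hB : ∀ r ∈ Ideal.span (Set.range y) ^ k, ∀ b : B, r • b = 0) {j : ℕ}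
    (x : Abelian.Ext B (ModuleCat.of R (LocProd y A)) j) : x = 0 := by
  classical
  have := Fintype.ofFinite ι
  let E := ModuleCat.of R (LocProd y A)
  let Φ : (E ⟶ E) →+ Abelian.Ext B E j :=
    AddMonoidHom.mk' (fun g => x.comp (Abelian.Ext.mk₀ g) (add_zero j)) (fun a b => by
      rw [Abelian.Ext.mk₀_add, Abelian.Ext.comp_add])
  let p (l : ι) : E ⟶ ModuleCat.of R (LocalizedModule (Submonoid.powers (y l)) A) :=
    ModuleCat.ofHom (LinearMap.proj l)
  let s (l : ι) : ModuleCat.of R (LocalizedModule (Submonoid.powers (y l)) A) ⟶ E :=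
    ModuleCat.ofHom
      (LinearMap.single R (fun l => LocalizedModule (Submonoid.powers (y l)) A) l)
  have h1 : 𝟙 E = ∑ l, p l ≫ s l := by
    apply ModuleCat.hom_ext
    refine LinearMap.ext fun v => ?_
    rw [ModuleCat.hom_sum, LinearMap.sum_apply]
    exact (Finset.univ_sum_single v).symm
  have h2 (l : ι) : Φ (p l ≫ s l) = 0 := by
    change x.comp (Abelian.Ext.mk₀ (p l ≫ s l)) (add_zero j) = 0
    rw [← Abelian.Ext.mk₀_comp_mk₀, ← Abelian.Ext.comp_assoc _ _ _ (add_zero j) (add_zero 0) (by lia),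
      ext_eq_zero_of_bijective_smul (r := y l ^ k)
        (hB _ (Ideal.pow_mem_pow (Ideal.subset_span (Set.mem_range_self l)) k)) ?_
        (x.comp (Abelian.Ext.mk₀ (p l)) (add_zero j)), Abelian.Ext.zero_comp]
    have := IsLocalizedModule.map_units
      (LocalizedModule.mkLinearMap (Submonoid.powers (y l)) A)
      (⟨y l ^ k, k, rfl⟩ : Submonoid.powers (y l))
    exact (Module.End.isUnit_iff _).1 this
  have h3 : Φ (𝟙 E) = x := Abelian.Ext.comp_mk₀_id x
  rw [← h3, h1, map_sum]
  exact Finset.sum_eq_zero fun l _ => h2 l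

theorem Ideal.smul_quotient_eq_zero {J : Ideal R} (r : R) (hr : r ∈ J) (b : R ⧸ J) : r • b = 0 := by
  obtain ⟨b, rfl⟩ := Ideal.Quotient.mk_surjective b
  exact Ideal.Quotient.eq_zero_iff_mem.2 (J.mul_mem_right b hr)

theorem LocProd.localCohomologyVanishes [Finite ι] (A : ModuleCat.{u} R) (i : ℕ) :
    LocalCohomologyVanishes (Ideal.span (Set.range y)) i (ModuleCat.of R (LocProd y A)) :=
  fun k x => ⟨k, le_rfl, by
    rw [LocProd.ext_eq_zero y (A := A) (k := k) (fun r hr b => Ideal.smul_quotient_eq_zero r hr b) x,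
      Abelian.Ext.comp_zero]⟩

/-- The image of `A` in the product of its localizations. -/
abbrev LocProd.range (A : Type u) [AddCommGroup A] [Module R A] : Submodule R (LocProd y A) :=
  LinearMap.range (LocProd.mk y A)

/-- The exact sequence `0 → A' → ∏ A_{y j} → C → 0`, where `A'` is the image of `A`. -/
def LocProd.shortComplex (A : Type u) [AddCommGroup A] [Module R A] :
    ShortComplex (ModuleCat.{u} R) :=
  ShortComplex.mk (ModuleCat.ofHom (LocProd.range y A).subtype)
    (ModuleCat.ofHom (LocProd.range y A).mkQ)
    (by ext r; exact (Submodule.Quotient.mk_eq_zero _).2 r.2)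

theorem LocProd.shortExact (A : Type u) [AddCommGroup A] [Module R A] :
    (LocProd.shortComplex y A).ShortExact :=
  ModuleCat.shortComplex_shortExact _
    (by
      intro r
      refine ⟨fun h => ⟨⟨r, (Submodule.Quotient.mk_eq_zero _).1 h⟩, rfl⟩, ?_⟩
      rintro ⟨r, rfl⟩
      exact (Submodule.Quotient.mk_eq_zero _).2 r.2)
    Subtype.val_injective (Submodule.mkQ_surjective _)

theorem LocProd.map_mem_range {A N : Type u} [AddCommGroup A] [Module R A] [AddCommGroup N]
    [Module R N] (f : A →ₗ[R] N) (v : LocProd y A) (hv : v ∈ LocProd.range y A) :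
    LocProd.map y f v ∈ LocProd.range y N := by
  obtain ⟨a, rfl⟩ := hv
  exact ⟨f a, (LocProd.map_mk y f a).symm⟩

/-- Functoriality of `LocProd.shortComplex`. -/
def LocProd.shortComplexMap {A N : Type u} [AddCommGroup A] [Module R A] [AddCommGroup N]
    [Module R N] (f : A →ₗ[R] N) : LocProd.shortComplex y A ⟶ LocProd.shortComplex y N where
  τ₁ := ModuleCat.ofHom ((LocProd.map y f).restrict (LocProd.map_mem_range y f))
  τ₂ := ModuleCat.ofHom (LocProd.map y f)
  τ₃ := ModuleCat.ofHom (Submodule.mapQ _ _ (LocProd.map y f) (LocProd.map_mem_range y f))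
  comm₁₂ := by ext v; rfl
  comm₂₃ := by ext v; rfl

/-- The kernel of `A` onto its image is torsion, so its H^(i+1) vanishes. -/
theorem LocProd.vanishes_X₁ [Finite ι] [IsNoetherianRing R] (A : ModuleCat.{u} R) (i : ℕ)
    (h : LocalCohomologyVanishes (Ideal.span (Set.range y)) i A) :
    LocalCohomologyVanishes (Ideal.span (Set.range y)) i (LocProd.shortComplex y A).X₁ :=
  .of_shortExact₃ (LinearMap.shortExact_shortComplexKer
      (LinearMap.surjective_rangeRestrict (LocProd.mk y A))) h
    (IsIdealPowTorsion.localCohomologyVanishes (by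
      have := LocProd.isIdealPowTorsion_ker y A
      rwa [← LinearMap.ker_rangeRestrict] at this) i)

theorem LocProd.vanishes_X₃ [Finite ι] [IsNoetherianRing R] (A : ModuleCat.{u} R) (i : ℕ)
    (h : LocalCohomologyVanishes (Ideal.span (Set.range y)) (i + 1) A) :
    LocalCohomologyVanishes (Ideal.span (Set.range y)) i (LocProd.shortComplex y A).X₃ :=
  .of_shortExact₃ (LocProd.shortExact y A) (LocProd.localCohomologyVanishes y A i)
    (LocProd.vanishes_X₁ y A (i + 1) h)

variable {y}

theorem LocalCohomologyVanishes.locProd_mk_injective [Finite ι] {A : ModuleCat.{u} R}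
    (h : LocalCohomologyVanishes (Ideal.span (Set.range y)) 0 A) :
    Function.Injective (LocProd.mk y A) := by
  rw [← LinearMap.ker_eq_bot, Submodule.eq_bot_iff]
  intro a ha
  obtain ⟨k, hk⟩ := LocProd.isIdealPowTorsion_ker y A ⟨a, ha⟩
  exact h.eq_zero_of_pow_smul fun r hr => congrArg Subtype.val (hk r hr)

/-- Let `H^i_I(A) = 0` for `i ≥ q` and `H^i_I(N) = 0` for `i < q`. Then a homomorphism `A → N`
induces the zero map on `Ext^j(B, -)` for all `B` killed by a power of `I`. -/
theorem ext_comp_eq_zero_of_vanishes [Finite ι] [IsNoetherianRing R] (q : ℕ) :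
    ∀ {A N : ModuleCat.{u} R} (f : A ⟶ N),
      (∀ i, q ≤ i → LocalCohomologyVanishes (Ideal.span (Set.range y)) i A) →
      (∀ i, i < q → LocalCohomologyVanishes (Ideal.span (Set.range y)) i N) →
      ∀ {B : ModuleCat.{u} R} {k : ℕ}, (∀ r ∈ Ideal.span (Set.range y) ^ k, ∀ b : B, r • b = 0) →
      ∀ (j : ℕ) (x : Abelian.Ext B A j), x.comp (Abelian.Ext.mk₀ f) (add_zero j) = 0 := by
  induction q with
  | zero =>
    intro A N f hA _ B k hB j x
    -- Here `A` has no local cohomology at all. It embeds in its localizations, the cokernel has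
    -- none either, and Ext^(j+1)(B, A) is a quotient of Ext^j(B, cokernel).
    suffices ∀ (j : ℕ) (A : ModuleCat.{u} R),
        (∀ i, LocalCohomologyVanishes (Ideal.span (Set.range y)) i A) →
        ∀ x : Abelian.Ext B A j, x = 0 by
      rw [this j A (fun i => hA i i.zero_le) x, Abelian.Ext.zero_comp]
    clear! A N j
    intro j
    induction j with
    | zero =>
      intro A hA x
      obtain ⟨φ, rfl⟩ := Abelian.Ext.addEquiv₀.symm.surjective x
      rw [Abelian.Ext.addEquiv₀_symm_apply, Abelian.Ext.mk₀_eq_zero_iff]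
      ext b
      exact (hA 0).eq_zero_of_pow_smul (k := k) fun r hr => by
        rw [← map_smul, hB r hr, map_zero]
    | succ j ih =>
      intro A hA x
      let e : A ≅ (LocProd.shortComplex y A).X₁ :=
        (LinearEquiv.ofInjective _ (hA 0).locProd_mk_injective).toModuleIso
      obtain ⟨w, hw⟩ := Abelian.Ext.covariant_sequence_exact₁ _ (LocProd.shortExact y A)
        (x.comp (Abelian.Ext.mk₀ e.hom) (add_zero _)) (LocProd.ext_eq_zero y hB _) rfl
      rw [ih _ (fun i => LocProd.vanishes_X₃ y A i (hA (i + 1))) w, Abelian.Ext.zero_comp] at hw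
      have := congrArg (fun t => Abelian.Ext.comp t (Abelian.Ext.mk₀ e.inv) (add_zero _)) hw.symm
      simpa using this
  | succ q ih =>
    intro A N f hA hN B k hB j x
    let e : N ≅ (LocProd.shortComplex y N).X₁ :=
      (LinearEquiv.ofInjective _ (hN 0 q.succ_pos).locProd_mk_injective).toModuleIso
    let τ := LocProd.shortComplexMap y f.hom
    let p : A ⟶ (LocProd.shortComplex y A).X₁ :=
      ModuleCat.ofHom (LinearMap.rangeRestrict (LocProd.mk y A))
    have hp : f ≫ e.hom = p ≫ τ.τ₁ := by
      ext a
      exact Subtype.ext (LocProd.map_mk y f.hom a).symm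
    -- `N` has no torsion, so it is its own image in the localizations. `A` may have torsion, but
    -- `f` still factors through the image of `A`.
    suffices h : (x.comp (Abelian.Ext.mk₀ p) (add_zero j)).comp (Abelian.Ext.mk₀ τ.τ₁)
        (add_zero j) = 0 by
      rw [Abelian.Ext.comp_assoc _ _ _ (add_zero j) (add_zero 0) (by lia),
        Abelian.Ext.mk₀_comp_mk₀, ← hp, ← Abelian.Ext.mk₀_comp_mk₀,
        ← Abelian.Ext.comp_assoc _ _ _ (add_zero j) (add_zero 0) (by lia)] at h
      have := congrArg (fun t => Abelian.Ext.comp t (Abelian.Ext.mk₀ e.inv) (add_zero _)) h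
      simpa using this
    generalize x.comp (Abelian.Ext.mk₀ p) (add_zero j) = x₀
    cases j with
    | zero =>
      obtain ⟨φ, rfl⟩ := Abelian.Ext.addEquiv₀.symm.surjective x₀
      rw [Abelian.Ext.addEquiv₀_symm_apply, Abelian.Ext.mk₀_comp_mk₀,
        Abelian.Ext.mk₀_eq_zero_iff]
      ext b
      exact ((hN 0 q.succ_pos).of_iso e).eq_zero_of_pow_smul (k := k) fun r hr => by
        rw [← map_smul, hB r hr, map_zero]
    | succ j =>
      obtain ⟨w, rfl⟩ := Abelian.Ext.covariant_sequence_exact₁ _ (LocProd.shortExact y A)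
        x₀ (LocProd.ext_eq_zero y hB _) rfl
      -- Naturality of the connecting class moves the question to the map of cokernels, where the
      -- threshold drops from q + 1 to q.
      rw [Abelian.Ext.comp_assoc _ _ _ rfl (add_zero 1) (by lia),
        ShortComplex.ShortExact.extClass_naturality _ (LocProd.shortExact y N) τ,
        ← Abelian.Ext.comp_assoc _ _ _ (add_zero j) (zero_add 1) (by lia),
        ih τ.τ₃ (fun i hi => LocProd.vanishes_X₃ y A i (hA (i + 1) (by lia)))
          (fun i hi => LocProd.vanishes_X₃ y N i (hN (i + 1) (by lia))) hB j w,
        Abelian.Ext.zero_comp]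

end

/-! ### Top Ext of a quotient by a regular sequence -/

section
variable {R : Type u} [CommRing R]

/-- The morphism `R ⟶ M` with `1 ↦ m`. -/
def ModuleCat.ofElement {M : ModuleCat.{u} R} (m : M) : ModuleCat.of R R ⟶ M :=
  ModuleCat.ofHom (LinearMap.toSpanSingleton R M m)

theorem ModuleCat.ofElement_comp {M N : ModuleCat.{u} R} (m : M) (f : M ⟶ N) :
    ModuleCat.ofElement m ≫ f = ModuleCat.ofElement (f.hom m) := by
  ext
  simp [ModuleCat.ofElement]

/-- The ideal `J` behaves like one generated by a regular sequence of length `d`: the functors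
`Ext^i(R/J, -)` vanish for `i > d`, and `Ext^d(R/J, M)` is naturally isomorphic to `M/JM`. -/
structure Ideal.HasTopExtQuotient (J : Ideal R) (d : ℕ) : Prop where
  eq_zero : ∀ (i : ℕ), d < i → ∀ (M : ModuleCat.{u} R)
    (x : Abelian.Ext (ModuleCat.of R (R ⧸ J)) M i), x = 0
  exists_class : ∃ e : Abelian.Ext (ModuleCat.of R (R ⧸ J)) (ModuleCat.of R R) d,
    ∀ (M : ModuleCat.{u} R),
      (∀ x : Abelian.Ext (ModuleCat.of R (R ⧸ J)) M d, ∃ m : M,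
        x = e.comp (Abelian.Ext.mk₀ (ModuleCat.ofElement m)) (add_zero d)) ∧
      ∀ m : M, e.comp (Abelian.Ext.mk₀ (ModuleCat.ofElement m)) (add_zero d) = 0 →
        m ∈ J • (⊤ : Submodule R M)

theorem Ideal.hasTopExtQuotient_bot : (⊥ : Ideal R).HasTopExtQuotient 0 := by
  let E : (R ⧸ (⊥ : Ideal R)) ≃ₗ[R] R := Submodule.quotEquivOfEqBot ⊥ rfl
  let e : ModuleCat.of R (R ⧸ (⊥ : Ideal R)) ≅ ModuleCat.of R R := E.toModuleIso
  have hp : Projective (ModuleCat.of R R) :=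
    ModuleCat.projective_of_free (Module.Basis.singleton Unit R)
  have : Projective (ModuleCat.of R (R ⧸ (⊥ : Ideal R))) := Projective.of_iso e.symm hp
  refine ⟨fun i hi M x => ?_, Abelian.Ext.mk₀ e.hom, fun M => ⟨fun x => ?_, fun m hm => ?_⟩⟩
  · obtain ⟨i, rfl⟩ := Nat.exists_eq_succ_of_ne_zero hi.ne'
    exact Abelian.Ext.eq_zero_of_projective x
  · obtain ⟨φ, rfl⟩ := Abelian.Ext.addEquiv₀.symm.surjective x
    refine ⟨(e.inv ≫ φ).hom (1 : R), ?_⟩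
    rw [Abelian.Ext.addEquiv₀_symm_apply, Abelian.Ext.mk₀_comp_mk₀]
    congr 1
    rw [← Iso.inv_comp_eq]
    ext
    simp [ModuleCat.ofElement]
  · rw [Abelian.Ext.mk₀_comp_mk₀, Abelian.Ext.mk₀_eq_zero_iff, ← cancel_epi e.inv,
      Iso.inv_hom_id_assoc, comp_zero] at hm
    have := congrArg (fun t => t.hom (1 : R)) hm
    have h0 : m = 0 := by simpa [ModuleCat.ofElement] using this
    rw [h0]
    exact zero_mem _

/-- The exact sequence `0 → R/J → R/J → R/(J + (r)) → 0`. -/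
abbrev Ideal.smulShortComplex (J : Ideal R) (r : R) : ShortComplex (ModuleCat.{u} R) :=
  ShortComplex.mk (r • 𝟙 (ModuleCat.of R (R ⧸ J)))
    (Ideal.quotientProj (le_sup_left : J ≤ J ⊔ Ideal.span {r})) (by
      ext
      change r • (1 : R ⧸ (J ⊔ Ideal.span {r})) = 0
      exact Ideal.smul_quotient_eq_zero r
        (Ideal.mem_sup_right (Ideal.mem_span_singleton_self r)) _)

theorem Ideal.smulShortComplex_shortExact {J : Ideal R} {r : R}
    (h : ∀ a : R, r * a ∈ J → a ∈ J) : (J.smulShortComplex r).ShortExact := by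
  refine ModuleCat.shortComplex_shortExact _ ?_ ?_ ?_
  · intro a
    refine ⟨fun ha => ?_, ?_⟩
    · obtain ⟨a, rfl⟩ := Ideal.Quotient.mk_surjective a
      have ha' : a ∈ J ⊔ Ideal.span {r} := (Submodule.Quotient.mk_eq_zero _).1 ha
      obtain ⟨b, hb, c, hc, rfl⟩ := Submodule.mem_sup.1 ha'
      obtain ⟨c, rfl⟩ := Ideal.mem_span_singleton'.1 hc
      refine ⟨Ideal.Quotient.mk J c, ?_⟩
      change Ideal.Quotient.mk J (r * c) = _
      rw [Ideal.Quotient.eq, show r * c - (b + c * r) = -b by ring]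
      exact neg_mem hb
    · rintro ⟨a, rfl⟩
      exact congrArg (fun t => t.hom a) (J.smulShortComplex r).zero
  · refine (injective_iff_map_eq_zero (J.smulShortComplex r).f.hom).2 fun a ha => ?_
    obtain ⟨a, rfl⟩ := Ideal.Quotient.mk_surjective a
    exact Ideal.Quotient.eq_zero_iff_mem.2 (h a ((Submodule.Quotient.mk_eq_zero _).1 ha))
  · intro a
    obtain ⟨a, rfl⟩ := Ideal.Quotient.mk_surjective a
    exact ⟨Ideal.Quotient.mk J a, rfl⟩

/-- In the long exact sequence of `Ideal.smulShortComplex`, the new top Ext is the cokernel of r on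
M/JM, that is M/(J + (r))M. The new class is the old one preceded by the connecting class. -/
theorem Ideal.HasTopExtQuotient.sup_span_singleton {J : Ideal R} {d : ℕ}
    (hJ : J.HasTopExtQuotient d) {r : R} (h : ∀ a : R, r * a ∈ J → a ∈ J) :
    (J ⊔ Ideal.span {r}).HasTopExtQuotient (d + 1) := by
  have hS := Ideal.smulShortComplex_shortExact h
  obtain ⟨h0, e, he⟩ := hJ
  refine ⟨fun i hi M x => ?_, hS.extClass.comp e (add_comm 1 d), fun M => ⟨fun x => ?_,
    fun m hm => ?_⟩⟩
  · obtain ⟨i, rfl⟩ := Nat.exists_eq_succ_of_ne_zero (Nat.ne_zero_of_lt hi)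
    obtain ⟨z, rfl⟩ := Abelian.Ext.contravariant_sequence_exact₃ hS M x (h0 _ (by lia) _ _)
      (add_comm 1 i)
    rw [h0 i (by lia) M z, Abelian.Ext.comp_zero]
  · obtain ⟨z, rfl⟩ := Abelian.Ext.contravariant_sequence_exact₃ hS M x (h0 _ (by lia) _ _)
      (add_comm 1 d)
    obtain ⟨m, rfl⟩ := (he M).1 z
    exact ⟨m, by rw [Abelian.Ext.comp_assoc _ _ _ (add_comm 1 d) (add_zero d) (by lia)]⟩
  · rw [Abelian.Ext.comp_assoc _ _ _ (add_comm 1 d) (add_zero d) (by lia)] at hm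
    obtain ⟨z, hz⟩ := Abelian.Ext.contravariant_sequence_exact₁ hS M _ (add_comm 1 d) hm
    obtain ⟨m₂, rfl⟩ := (he M).1 z
    -- The class of `m` is r times that of `m₂`, hence `m - r • m₂` lies in JM.
    have h1 : e.comp (Abelian.Ext.mk₀ (ModuleCat.ofElement (m - r • m₂))) (add_zero d) = 0 := by
      have h2 : ModuleCat.ofElement (m - r • m₂) =
          ModuleCat.ofElement m + (-r) • ModuleCat.ofElement m₂ := by
        ext
        simp [ModuleCat.ofElement, sub_eq_add_neg]
      rw [h2, Abelian.Ext.mk₀_add, Abelian.Ext.comp_add, ← hz, Abelian.Ext.mk₀_smul,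
        Abelian.Ext.mk₀_smul, Abelian.Ext.comp_smul, Abelian.Ext.smul_comp,
        Abelian.Ext.mk₀_id_comp, neg_smul, add_neg_cancel]
    have h3 := Submodule.smul_mono_left (le_sup_left : J ≤ J ⊔ Ideal.span {r}) ((he M).2 _ h1)
    have h4 : r • m₂ ∈ (J ⊔ Ideal.span {r}) • (⊤ : Submodule R M) :=
      Submodule.smul_mem_smul (Ideal.mem_sup_right (Ideal.mem_span_singleton_self r)) trivial
    simpa using add_mem h3 h4

/-- If `f : A ⟶ N` induces zero on the top `Ext^d(R/J, -)`, then `f` maps `A` into `J N`. -/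
theorem Ideal.HasTopExtQuotient.apply_mem_smul_top {J : Ideal R} {d : ℕ}
    (hJ : J.HasTopExtQuotient d) {A N : ModuleCat.{u} R} (f : A ⟶ N)
    (hf : ∀ x : Abelian.Ext (ModuleCat.of R (R ⧸ J)) A d,
      x.comp (Abelian.Ext.mk₀ f) (add_zero d) = 0) (a : A) :
    f.hom a ∈ J • (⊤ : Submodule R N) := by
  obtain ⟨-, e, he⟩ := hJ
  refine (he N).2 _ ?_
  have := hf (e.comp (Abelian.Ext.mk₀ (ModuleCat.ofElement a)) (add_zero d))
  rwa [Abelian.Ext.comp_assoc _ _ _ (add_zero d) (add_zero 0) (by lia),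
    Abelian.Ext.mk₀_comp_mk₀, ModuleCat.ofElement_comp] at this

/-- If the powers of `I` are cofinal with ideals `J` such that `Ext^i(R/J, -) = 0` for `i > d`,
then `H^i_I = 0` for `i > d`. -/
theorem localCohomologyVanishes_of_lt {I : Ideal R} {d : ℕ} (J : ℕ → Ideal R)
    (hJ : ∀ k, (J k).HasTopExtQuotient d) (hle : ∀ k, J k ≤ I ^ k)
    (hpow : ∀ k, ∃ l, I ^ l ≤ J k) {i : ℕ} (hi : d < i) (M : ModuleCat.{u} R) :
    LocalCohomologyVanishes I i M := by
  intro k x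
  obtain ⟨l, hl⟩ := hpow k
  refine ⟨k + l, by lia, ?_⟩
  change extRestrict _ _ = 0
  rw [← extRestrict_extRestrict ((Ideal.pow_le_pow_right (by lia)).trans hl) (hle k),
    (hJ k).eq_zero i hi M (extRestrict (hle k) x), extRestrict_zero]

end

/-! ### Powers of the variables y_j in the polynomial ring -/

section Polynomial

variable (K : Type u) [Field K] (m n : ℕ)

/-- The ideal generated by the `k`-th powers of the `y j` with `j ∈ s`. -/
def yPowIdeal (k : ℕ) (s : Finset (Fin n)) : Ideal (BigradedPoly K m n) :=
  Ideal.span ((fun j => (MvPolynomial.X (Sum.inr j) : BigradedPoly K m n) ^ k) '' s)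

variable {K m n}

theorem mem_yPowIdeal_iff {k : ℕ} {s : Finset (Fin n)} {f : BigradedPoly K m n} :
    f ∈ yPowIdeal K m n k s ↔ ∀ e ∈ f.support, ∃ j ∈ s, k ≤ e (Sum.inr j) := by
  have h : ((fun j => (MvPolynomial.X (Sum.inr j) : BigradedPoly K m n) ^ k) '' (s : Set (Fin n))) =
      (fun e => MvPolynomial.monomial e (1 : K)) ''
        ((fun j => Finsupp.single (Sum.inr j) k) '' (s : Set (Fin n))) := by
    rw [Set.image_image]
    exact Set.image_congr fun j _ => MvPolynomial.X_pow_eq_monomial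
  rw [yPowIdeal, h, MvPolynomial.mem_ideal_span_monomial_image]
  simp [Finsupp.single_le_iff]

/-- This is the regular sequence condition: multiplying by a power of y_j leaves the exponents of
the y_l, l ∈ s, unchanged. -/
theorem mem_yPowIdeal_of_X_pow_mul {k : ℕ} {s : Finset (Fin n)} {j : Fin n} (hj : j ∉ s)
    (f : BigradedPoly K m n) (h : MvPolynomial.X (Sum.inr j) ^ k * f ∈ yPowIdeal K m n k s) :
    f ∈ yPowIdeal K m n k s := by
  rw [mem_yPowIdeal_iff] at h ⊢
  intro e he
  obtain ⟨l, hl, hle⟩ := h (Finsupp.single (Sum.inr j) k + e) (by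
    rw [MvPolynomial.mem_support_iff, MvPolynomial.X_pow_eq_monomial,
      MvPolynomial.coeff_monomial_mul, one_mul]
    exact MvPolynomial.mem_support_iff.1 he)
  refine ⟨l, hl, ?_⟩
  have : j ≠ l := fun h => hj (h ▸ hl)
  simpa [this] using hle

theorem yPowIdeal_hasTopExtQuotient (k : ℕ) (s : Finset (Fin n)) :
    (yPowIdeal K m n k s).HasTopExtQuotient s.card := by
  induction s using Finset.induction_on with
  | empty => simpa [yPowIdeal] using Ideal.hasTopExtQuotient_bot
  | insert j s hj ih =>
    have := ih.sup_span_singleton (mem_yPowIdeal_of_X_pow_mul hj)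
    rw [Finset.card_insert_of_notMem hj]
    rw [yPowIdeal, Finset.coe_insert, Set.image_insert_eq, Set.insert_eq, Set.union_comm,
      Ideal.span_union]
    exact this

theorem yPowIdeal_le (k : ℕ) : yPowIdeal K m n k Finset.univ ≤ irrelevantQ K m n ^ k := by
  rw [yPowIdeal, Ideal.span_le]
  rintro _ ⟨j, -, rfl⟩
  exact Ideal.pow_mem_pow (Ideal.subset_span (Set.mem_range_self j)) k

theorem exists_pow_le_yPowIdeal (k : ℕ) :
    ∃ l, irrelevantQ K m n ^ l ≤ yPowIdeal K m n k Finset.univ := by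
  refine Ideal.exists_pow_le_of_le_radical_of_fg ?_ (Submodule.fg_span (Set.finite_range _))
  rw [irrelevantQ, Ideal.span_le]
  rintro _ ⟨j, rfl⟩
  exact ⟨k, Ideal.subset_span ⟨j, by simp, rfl⟩⟩

theorem irrelevantQ_localCohomologyVanishes {i : ℕ} (hi : n < i)
    (M : ModuleCat.{u} (BigradedPoly K m n)) :
    LocalCohomologyVanishes (irrelevantQ K m n) i M :=
  localCohomologyVanishes_of_lt (fun k => yPowIdeal K m n k Finset.univ)
    (fun k => yPowIdeal_hasTopExtQuotient k _) yPowIdeal_le exists_pow_le_yPowIdeal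
    (by simpa using hi) M

/-- If `H^i_Q(A) = 0` for `i ≥ q` and `H^i_Q(N) = 0` for `i < q`, then any homomorphism `A ⟶ N`
has image in all `Q^k N`. -/
theorem apply_mem_pow_smul_top_of_vanishes {A N : ModuleCat.{u} (BigradedPoly K m n)} (f : A ⟶ N)
    (q : ℕ) (hA : ∀ i, q ≤ i → LocalCohomologyVanishes (irrelevantQ K m n) i A)
    (hN : ∀ i, i < q → LocalCohomologyVanishes (irrelevantQ K m n) i N) (a : A) (k : ℕ) :
    f.hom a ∈ irrelevantQ K m n ^ k • (⊤ : Submodule (BigradedPoly K m n) N) := by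
  obtain ⟨l, hl⟩ := exists_pow_le_yPowIdeal (K := K) (m := m) (n := n) k
  refine Submodule.smul_mono_left (yPowIdeal_le k)
    ((yPowIdeal_hasTopExtQuotient k Finset.univ).apply_mem_smul_top f (fun x => ?_) a)
  exact ext_comp_eq_zero_of_vanishes q f hA hN (k := l)
    (fun r hr b => Ideal.smul_quotient_eq_zero r (hl hr) b) _ x

end Polynomial

/-! ### Cohomological dimension is monotone in the support -/

section
variable {R : Type u} [CommRing R] {I : Ideal R} {i : ℕ}

/-- The vanishing of `H^i_I(M)` for an unbundled module `M`. -/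
abbrev LocCohomVanishes (I : Ideal R) (i : ℕ) (M : Type u) [AddCommGroup M] [Module R M] : Prop :=
  LocalCohomologyVanishes I i (ModuleCat.of R M)

section Exact

variable {A B C : Type u} [AddCommGroup A] [Module R A] [AddCommGroup B] [Module R B]
  [AddCommGroup C] [Module R C] {f : A →ₗ[R] B} {g : B →ₗ[R] C}

theorem Function.Exact.moduleCat_shortExact (hf : Function.Injective f)
    (hg : Function.Surjective g) (h : Function.Exact f g) :
    (ModuleCat.shortComplexOfCompEqZero f g h.linearMap_comp_eq_zero).ShortExact :=
  ModuleCat.shortComplex_shortExact _ h hf hg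

theorem LocCohomVanishes.middle (hf : Function.Injective f) (hg : Function.Surjective g)
    (h : Function.Exact f g) (hA : LocCohomVanishes I i A) (hC : LocCohomVanishes I i C) :
    LocCohomVanishes I i B :=
  .of_shortExact₂ (h.moduleCat_shortExact hf hg) hA hC

theorem LocCohomVanishes.right (hf : Function.Injective f) (hg : Function.Surjective g)
    (h : Function.Exact f g) (hB : LocCohomVanishes I i B) (hA : LocCohomVanishes I (i + 1) A) :
    LocCohomVanishes I i C :=
  .of_shortExact₃ (h.moduleCat_shortExact hf hg) hB hA

theorem LocCohomVanishes.congr (e : A ≃ₗ[R] B) (hA : LocCohomVanishes I i A) :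
    LocCohomVanishes I i B :=
  .of_iso e.toModuleIso hA

end Exact

variable [IsNoetherianRing R]

/-- If `H^i_I(R/p) = 0` for all primes `p` in the support of `M`, then `H^i_I(M) = 0`. -/
theorem LocCohomVanishes.of_quotient_primes (M : Type u) [AddCommGroup M] [Module R M]
    [hM : Module.Finite R M]
    (h : ∀ p : Ideal R, p.IsPrime → Module.annihilator R M ≤ p → LocCohomVanishes I i (R ⧸ p)) :
    LocCohomVanishes I i M := by
  revert h
  induction hM using IsNoetherianRing.induction_on_isQuotientEquivQuotientPrime R with
  | subsingleton N => exact fun _ => .of_subsingleton _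
  | quotient N p e =>
    intro h
    refine (h p.1 p.2 ?_).congr e.symm
    rw [e.annihilator_eq, Ideal.annihilator_quotient]
  | exact N₁ N₂ N₃ f g hf hg hfg h₁ h₃ =>
    intro h
    exact .middle hf hg hfg
      (h₁ fun p hp hle => h p hp ((f.annihilator_le_of_injective hf).trans hle))
      (h₃ fun p hp hle => h p hp ((g.annihilator_le_of_surjective hg).trans hle))

/-- A finitely generated module has a nonzero homomorphism to `R/p` for `p` in its support. -/
theorem exists_linearMap_quotient_ne_zero (N : Type u) [AddCommGroup N] [Module R N]
    [Module.Finite R N] (p : Ideal R) [hp : p.IsPrime] (h : Module.annihilator R N ≤ p) :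
    ∃ φ : N →ₗ[R] R ⧸ p, φ ≠ 0 := by
  by_contra! hφ
  have : Subsingleton (N →ₗ[R] R ⧸ p) := subsingleton_of_forall_eq 0 hφ
  obtain ⟨r, hr, hreg⟩ := IsSMulRegular.subsingleton_linearMap_iff.1 this
  have h0 : r • (1 : R ⧸ p) = r • (0 : R ⧸ p) := by
    rw [smul_zero]; exact Ideal.smul_quotient_eq_zero r (h hr) _
  exact one_ne_zero (hreg h0)

/-- Noetherian induction, larger primes first. A nonzero map N → R/p has image with H^i = 0, because
H^(i+1) of its kernel vanishes; its cokernel is supported on primes strictly above p. -/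
theorem LocCohomVanishes.quotient_prime_aux (N : Type u) [AddCommGroup N] [Module R N]
    [Module.Finite R N] (hN : LocCohomVanishes I i N)
    (hsucc : ∀ p : Ideal R, p.IsPrime → Module.annihilator R N ≤ p →
      LocCohomVanishes I (i + 1) (R ⧸ p)) (p : Ideal R) (hp : p.IsPrime)
    (hle : Module.annihilator R N ≤ p) : LocCohomVanishes I i (R ⧸ p) := by
  induction p using WellFoundedGT.induction with
  | ind p ih =>
  obtain ⟨φ, hφ⟩ := exists_linearMap_quotient_ne_zero N p hle
  have hrange : LocCohomVanishes I i (LinearMap.range φ) :=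
    .right (LinearMap.ker φ).injective_subtype φ.surjective_rangeRestrict
      (fun x => by simp [Subtype.ext_iff]) hN
      (.of_quotient_primes _ fun p' hp' hle' => hsucc p' hp' <|
        ((LinearMap.ker φ).subtype.annihilator_le_of_injective
          (LinearMap.ker φ).injective_subtype).trans hle')
  refine .middle (LinearMap.range φ).injective_subtype (LinearMap.range φ).mkQ_surjective
    (LinearMap.exact_subtype_mkQ _) hrange (.of_quotient_primes _ fun p' hp' hle' => ?_)
  have hpp : p ≤ Module.annihilator R ((R ⧸ p) ⧸ LinearMap.range φ) := by
    refine le_trans ?_ ((LinearMap.range φ).mkQ.annihilator_le_of_surjective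
      (LinearMap.range φ).mkQ_surjective)
    rw [Ideal.annihilator_quotient]
  refine ih p' (lt_of_le_of_ne (hpp.trans hle') ?_) hp' (hle.trans (hpp.trans hle'))
  -- If p itself were in the support of the cokernel, then `φ x ≠ 0`, whose lift `a` annihilates the
  -- cokernel, would give `a` in p.
  rintro rfl
  obtain ⟨x, hx⟩ : ∃ x, φ x ≠ 0 := by
    by_contra! h
    exact hφ (LinearMap.ext h)
  obtain ⟨a, ha⟩ := Ideal.Quotient.mk_surjective (φ x)
  refine hx (ha ▸ Ideal.Quotient.eq_zero_iff_mem.2 (hle' (Module.mem_annihilator.2 fun z => ?_)))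
  obtain ⟨z, rfl⟩ := Submodule.mkQ_surjective _ z
  obtain ⟨z, rfl⟩ := Ideal.Quotient.mk_surjective z
  rw [← map_smul]
  refine (Submodule.Quotient.mk_eq_zero _).2 ⟨z • x, ?_⟩
  rw [map_smul, ← ha]
  change Ideal.Quotient.mk p (z * a) = Ideal.Quotient.mk p (a * z)
  rw [mul_comm]

/-- The cohomological dimension is monotone in the support. -/
theorem LocCohomVanishes.quotient_prime {d : ℕ}
    (hd : ∀ i, d < i → ∀ M : ModuleCat.{u} R, LocalCohomologyVanishes I i M)
    (N : Type u) [AddCommGroup N] [Module R N] [Module.Finite R N] (c : ℕ)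
    (hN : ∀ i, c ≤ i → LocCohomVanishes I i N) {p : Ideal R} (hp : p.IsPrime)
    (hle : Module.annihilator R N ≤ p) (hi : c ≤ i) : LocCohomVanishes I i (R ⧸ p) := by
  -- Descending induction on i: `t` bounds the distance to the range where all local cohomology
  -- vanishes.
  obtain ⟨t, ht⟩ : ∃ t, d < i + t := ⟨d + 1, by lia⟩
  induction t generalizing i p with
  | zero => exact hd _ ht _
  | succ t ih =>
    exact .quotient_prime_aux N (hN i hi)
      (fun p hp hle => ih hp hle (by lia) (by lia)) p hp hle

end

/-! ### The bigrading and Q-adic separation -/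

section Graded

variable {K : Type u} [Field K] {m n : ℕ} {M : Type u} [AddCommGroup M]
  [Module (BigradedPoly K m n) M] (ℳ : ℤ × ℤ → AddSubgroup M) [DirectSum.Decomposition ℳ]

theorem decompose_smul_apply [SetLike.GradedSMul (polyBigrading K m n) ℳ] {e : ℤ × ℤ}
    {s : BigradedPoly K m n} (hs : s ∈ polyBigrading K m n e) (w : M) (d : ℤ × ℤ) :
    (DirectSum.decompose ℳ (s • w) d : M) = s • (DirectSum.decompose ℳ w (d - e) : M) := by
  induction w using DirectSum.Decomposition.inductionOn ℳ with
  | zero => simp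
  | @homogeneous d' w =>
    have h : s • (w : M) ∈ ℳ (e + d') := SetLike.GradedSMul.smul_mem hs w.2
    by_cases hd : d = e + d'
    · subst hd
      rw [DirectSum.decompose_of_mem_same ℳ h, add_sub_cancel_left,
        DirectSum.decompose_of_mem_same ℳ w.2]
    · rw [DirectSum.decompose_of_mem_ne ℳ h (Ne.symm hd),
        DirectSum.decompose_of_mem_ne ℳ w.2 (by rintro rfl; simp at hd), smul_zero]
  | add w w' h h' =>
    simp only [smul_add, DirectSum.decompose_add, DirectSum.add_apply, AddSubgroup.coe_add, h, h']

variable [SetLike.GradedSMul (polyBigrading K m n) ℳ] (F : Submodule (BigradedPoly K m n) M)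

/-- The elements whose components of `y`-degree less than `b` lie in `F`. -/
def yDegreeGE (b : ℤ) : Submodule (BigradedPoly K m n) M where
  carrier := {w | ∀ d : ℤ × ℤ, d.2 < b → (DirectSum.decompose ℳ w d : M) ∈ F}
  add_mem' {w w'} h h' d hd := by
    rw [DirectSum.decompose_add, DirectSum.add_apply, AddSubgroup.coe_add]
    exact add_mem (h d hd) (h' d hd)
  zero_mem' d _ := by simp
  smul_mem' s w hw := by
    induction s using MvPolynomial.induction_on generalizing w with
    | C a =>
      intro d hd
      have hC : (MvPolynomial.C a : BigradedPoly K m n) ∈ polyBigrading K m n 0 :=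
        MvPolynomial.isWeightedHomogeneous_C _ a
      rw [decompose_smul_apply ℳ hC, sub_zero]
      exact F.smul_mem _ (hw d hd)
    | add s t hs ht =>
      intro d hd
      rw [add_smul, DirectSum.decompose_add, DirectSum.add_apply, AddSubgroup.coe_add]
      exact add_mem (hs w hw d hd) (ht w hw d hd)
    | mul_X s v hs =>
      rw [mul_smul]
      refine hs _ fun d hd => ?_
      have hX : (MvPolynomial.X v : BigradedPoly K m n) ∈
          polyBigrading K m n (varBidegree m n v) :=
        MvPolynomial.isWeightedHomogeneous_X _ _ v
      rw [decompose_smul_apply ℳ hX]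
      refine F.smul_mem _ (hw _ (lt_of_le_of_lt ?_ hd))
      cases v <;> simp [varBidegree]

theorem irrelevantQ_smul_mem_yDegreeGE {b : ℤ} {r : BigradedPoly K m n}
    (hr : r ∈ irrelevantQ K m n) {w : M} (hw : w ∈ yDegreeGE ℳ F b) :
    r • w ∈ yDegreeGE ℳ F (b + 1) := by
  induction hr using Submodule.span_induction with
  | mem x hx =>
    obtain ⟨j, rfl⟩ := hx
    intro d hd
    have hX : (MvPolynomial.X (Sum.inr j) : BigradedPoly K m n) ∈
        polyBigrading K m n (varBidegree m n (Sum.inr j)) :=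
      MvPolynomial.isWeightedHomogeneous_X _ _ _
    rw [decompose_smul_apply ℳ hX]
    refine F.smul_mem _ (hw _ ?_)
    change d.2 - 1 < b
    lia
  | zero => rw [zero_smul]; exact zero_mem _
  | add x y _ _ hx hy => rw [add_smul]; exact add_mem hx hy
  | smul a x _ hx => rw [smul_assoc]; exact Submodule.smul_mem _ a hx

theorem exists_mem_yDegreeGE (w : M) : ∃ b, w ∈ yDegreeGE ℳ F b := by
  classical
  obtain ⟨b, hb⟩ := ((DirectSum.decompose ℳ w).support.image Prod.snd).bddBelow
  refine ⟨b, fun d hd => ?_⟩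
  have : d ∉ (DirectSum.decompose ℳ w).support := fun h =>
    absurd (hb (Finset.mem_coe.2 (Finset.mem_image_of_mem _ h))) (not_le.2 hd)
  rw [DFinsupp.notMem_support_iff.1 this]
  exact zero_mem _

variable {ℳ F}

/-- Krull-type separation: a homogeneous submodule is closed in the `Q`-adic topology. -/
theorem mem_of_sub_smul_mem (hF : F.IsHomogeneous ℳ) {r : BigradedPoly K m n}
    (hr : r ∈ irrelevantQ K m n) {x : M} (hx : x - r • x ∈ F) : x ∈ F := by
  have hle (b : ℤ) : F ≤ yDegreeGE ℳ F b := fun w hw d _ => hF d hw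
  have hstep (b : ℤ) (h : x ∈ yDegreeGE ℳ F b) : x ∈ yDegreeGE ℳ F (b + 1) := by
    -- Modulo F, x equals r x, and r raises the y-degree by at least one.
    rw [← sub_add_cancel x (r • x)]
    exact add_mem (hle _ hx) (irrelevantQ_smul_mem_yDegreeGE ℳ F hr h)
  obtain ⟨b, hb⟩ := exists_mem_yDegreeGE ℳ F x
  have hall (k : ℕ) : x ∈ yDegreeGE ℳ F (b + k) := by
    induction k with
    | zero => simpa using hb
    | succ k ih => simpa [add_assoc] using hstep _ ih
  rw [DirectSum.AddSubmonoidClass.IsHomogeneous.mem_iff ℳ F hF]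
  intro d
  exact hall (d.2 + 1 - b).toNat d (by lia)

/-- An associated prime of a bigraded subquotient `F'/F` with `H^j_Q(F'/F) = 0` for `j < q`
has cohomological dimension at least `q`. -/
theorem exists_not_vanishes_of_isAssociatedPrime {F F' : Submodule (BigradedPoly K m n) M}
    [Module.Finite (BigradedPoly K m n) M] (hF : F.IsHomogeneous ℳ) {q : ℕ}
    (hN : ∀ j, j < q → LocCohomVanishes (irrelevantQ K m n) j (F' ⧸ F.submoduleOf F'))
    {p : Ideal (BigradedPoly K m n)} (hp : IsAssociatedPrime p (F' ⧸ F.submoduleOf F')) :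
    ∃ j, q ≤ j ∧ ¬ LocCohomVanishes (irrelevantQ K m n) j (BigradedPoly K m n ⧸ p) := by
  by_contra! hA
  obtain ⟨hprime, f, hf⟩ := (isAssociatedPrime_iff_exists_injective_linearMap _ _).1 hp
  have hmem (k : ℕ) := apply_mem_pow_smul_top_of_vanishes (ModuleCat.ofHom f) q hA hN 1 k
  -- Krull's intersection theorem only gives r in Q fixing f(1); the bigrading finishes the
  -- argument.
  obtain ⟨⟨r, hr⟩, hrx⟩ := (Ideal.mem_iInf_smul_pow_eq_bot_iff (irrelevantQ K m n) (f 1)).1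
    ((Submodule.mem_iInf _).2 hmem)
  obtain ⟨⟨x, hx⟩, hfx⟩ := Submodule.mkQ_surjective _ (f 1)
  rw [← hfx, ← map_smul, ← sub_eq_zero, ← map_sub, Submodule.mkQ_apply,
    Submodule.Quotient.mk_eq_zero] at hrx
  have hsub : x - r • x ∈ F := by
    have : r • x - x ∈ F := hrx
    rw [← neg_sub]
    exact neg_mem this
  have h0 : f 1 = 0 := by
    rw [← hfx]
    exact (Submodule.Quotient.mk_eq_zero _).2 (mem_of_sub_smul_mem hF hr hsub)
  exact one_ne_zero (hf (h0.trans (map_zero f).symm))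

end Graded

/-! ### Numerical values of `cohDim` -/

section CohDim

variable {R : Type u} [CommRing R] {I : Ideal R} {M : Type u} [AddCommGroup M] [Module R M]

theorem nontrivial_localCohomology_iff (i : ℕ) :
    Nontrivial ((localCohomology I i).obj (ModuleCat.of R M)) ↔ ¬ LocCohomVanishes I i M := by
  rw [← not_subsingleton_iff_nontrivial, localCohomologyVanishes_iff]

theorem cohDim_eq_of_vanishes {q : ℕ} (hq : ¬ LocCohomVanishes I q M)
    (h : ∀ j, q < j → LocCohomVanishes I j M) : cohDim I M = ((q : ℕ∞) : WithBot ℕ∞) := by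
  refine le_antisymm (iSup₂_le fun i hi => ?_)
    (le_iSup₂_of_le q ((nontrivial_localCohomology_iff q).2 hq) le_rfl)
  rw [nontrivial_localCohomology_iff] at hi
  have : i ≤ q := not_lt.1 fun hlt => hi (h i hlt)
  exact_mod_cast this

theorem exists_not_vanishes_of_le_cohDim {q : ℕ} (h : ((q : ℕ∞) : WithBot ℕ∞) ≤ cohDim I M) :
    ∃ j, q ≤ j ∧ ¬ LocCohomVanishes I j M := by
  by_contra! hv
  refine absurd h (not_le.2 ?_)
  cases q with
  | zero =>
    -- With no nonvanishing degree the supremum is ⊥, which lies strictly below 0.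
    refine lt_of_le_of_lt (iSup₂_le fun i hi => ?_) (WithBot.bot_lt_coe _)
    exact absurd (hv i i.zero_le) ((nontrivial_localCohomology_iff i).1 hi)
  | succ q =>
    have hq : ((q : ℕ∞) : WithBot ℕ∞) < ((q + 1 : ℕ) : ℕ∞) := by
      exact_mod_cast q.lt_succ_self
    refine lt_of_le_of_lt (iSup₂_le fun i hi => ?_) hq
    rw [nontrivial_localCohomology_iff] at hi
    have : i ≤ q := not_lt.1 fun hlt => hi (hv i hlt)
    exact_mod_cast this

/-- Nonnegativity of `cohDim` excludes total vanishing, so the integer in the definition is a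
natural number and its degree is nonzero. -/
theorem IsRelCohenMacaulay.exists_degree (h : IsRelCohenMacaulay I M) (h0 : 0 ≤ cohDim I M) :
    ∃ q : ℕ, ¬ LocCohomVanishes I q M ∧ ∀ j, j ≠ q → LocCohomVanishes I j M := by
  obtain ⟨q, hq⟩ := h
  obtain ⟨j, -, hj⟩ := exists_not_vanishes_of_le_cohDim (q := 0) h0
  have hjq : (j : ℤ) = q := by
    by_contra hne
    exact hj ((localCohomologyVanishes_iff I j _).1 (hq j hne))
  refine ⟨j, hj, fun i hi => (localCohomologyVanishes_iff I i _).1 (hq i fun h => hi ?_)⟩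
  exact_mod_cast h.trans hjq.symm

end CohDim

/-! ### Associated primes of a quotient -/

section AssociatedPrimes

variable {R : Type u} [CommRing R] [IsNoetherianRing R] {M : Type u} [AddCommGroup M] [Module R M]

/-- An associated prime of `M/L` not containing the annihilator of `L` is associated to `M`. -/
theorem IsAssociatedPrime.of_quotient {L : Submodule R M} {p : Ideal R}
    (hp : IsAssociatedPrime p (M ⧸ L)) (h : ¬ L.annihilator ≤ p) : IsAssociatedPrime p M := by
  obtain ⟨hprime, x, hx⟩ := isAssociatedPrime_iff.1 hp
  obtain ⟨x, rfl⟩ := L.mkQ_surjective x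
  obtain ⟨s, hs, hsp⟩ := Set.not_subset.1 h
  have hmem (a : R) : a ∈ p ↔ a • x ∈ L := by
    rw [hx, Submodule.mem_colon_singleton, Submodule.mem_bot, ← map_smul, Submodule.mkQ_apply,
      Submodule.Quotient.mk_eq_zero]
  refine isAssociatedPrime_iff.2 ⟨hprime, s • x, Ideal.ext fun a => ?_⟩
  rw [Submodule.mem_colon_singleton, Submodule.mem_bot]
  constructor
  · intro ha
    rw [smul_comm]
    exact Submodule.mem_annihilator.1 hs _ ((hmem a).1 ha)
  · intro ha
    have : a * s ∈ p := (hmem _).2 (by rw [mul_smul, ha]; exact zero_mem _)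
    exact (hprime.mem_or_mem this).resolve_right hsp

end AssociatedPrimes

/-! ### The filtration and the main theorem -/

section Filtration

variable {R : Type u} [CommRing R] {I : Ideal R} {M : Type u} [AddCommGroup M] [Module R M] {r : ℕ}
  {F : Fin (r + 1) → Submodule R M}

theorem submoduleOf_inclusion_exact {L N : Submodule R M} (h : L ≤ N) :
    Function.Exact (Submodule.inclusion h) (L.submoduleOf N).mkQ := by
  intro x
  rw [Submodule.mkQ_apply, Submodule.Quotient.mk_eq_zero]
  exact ⟨fun hx => ⟨⟨x, hx⟩, rfl⟩, by rintro ⟨y, rfl⟩; exact y.2⟩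

theorem locCohomVanishes_of_filtQuot (h0 : F 0 = ⊥) (hF : Monotone F) {l : ℕ} (k : Fin (r + 1))
    (h : ∀ j : Fin r, j.castSucc < k → LocCohomVanishes I l (FiltQuot F j)) :
    LocCohomVanishes I l (F k) := by
  induction k using Fin.induction with
  | zero =>
    rw [h0]
    exact .of_subsingleton _
  | succ k ih =>
    exact .middle (Submodule.inclusion_injective (hF k.castSucc_le_succ))
      (Submodule.mkQ_surjective _) (submoduleOf_inclusion_exact _)
      (ih fun j hj => h j (hj.trans_le k.castSucc_le_succ)) (h k k.castSucc_lt_succ)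

end Filtration

theorem mainTheorem11 {K : Type u} [Field K] (m n : ℕ)
    (M : Type u) [AddCommGroup M] [Module (BigradedPoly K m n) M]
    [Module.Finite (BigradedPoly K m n) M]
    (ℳ : ℤ × ℤ → AddSubgroup M) [DirectSum.Decomposition ℳ]
    [SetLike.GradedSMul (polyBigrading K m n) ℳ]
    (r : ℕ) (F : Fin (r + 1) → Submodule (BigradedPoly K m n) M)
    (hF : IsCohenMacaulayFiltration ℳ F) (i : Fin r) :
    associatedPrimes (BigradedPoly K m n) (FiltQuot F i) =
        {p ∈ associatedPrimes (BigradedPoly K m n) (F i.succ) |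
          cohDim (irrelevantQ K m n) (BigradedPoly K m n ⧸ p) =
            cohDim (irrelevantQ K m n) (F i.succ)} ∧
      (associatedPrimes (BigradedPoly K m n) (FiltQuot F i) =
          associatedPrimes (BigradedPoly K m n) (F i.succ) ↔
        IsRelUnmixed (irrelevantQ K m n) (F i.succ)) := by
  have hmain : associatedPrimes (BigradedPoly K m n) (FiltQuot F i) =
      {p ∈ associatedPrimes (BigradedPoly K m n) (F i.succ) |
        cohDim (irrelevantQ K m n) (BigradedPoly K m n ⧸ p) =
          cohDim (irrelevantQ K m n) (F i.succ)} := by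
    have hex (j : Fin r) := (hF.isRelCohenMacaulay j).exists_degree (hF.cohDim_nonneg j)
    choose q hq hv using hex
    have hqF (j : Fin r) := cohDim_eq_of_vanishes (hq j) fun l hl => hv j l hl.ne'
    have hqlt {j k : Fin r} (h : j < k) : q j < q k := by
      have := hF.cohDim_strictMono h
      simp only [hqF] at this
      exact_mod_cast this
    have hmono := hF.strictMono.monotone
    have hle : F i.castSucc ≤ F i.succ := hmono i.castSucc_le_succ
    -- All earlier quotients have their cohomology in degrees strictly below `q i`.
    have hvlow (l : ℕ) (hl : q i ≤ l) :
        LocCohomVanishes (irrelevantQ K m n) l (F i.castSucc) :=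
      locCohomVanishes_of_filtQuot hF.zero_eq_bot hmono _ fun j hj =>
        hv j l ((hqlt (Fin.castSucc_lt_castSucc_iff.1 hj)).trans_le hl).ne'
    have hvup (l : ℕ) (hl : q i < l) : LocCohomVanishes (irrelevantQ K m n) l (F i.succ) :=
      .middle (Submodule.inclusion_injective hle) (Submodule.mkQ_surjective _)
        (submoduleOf_inclusion_exact hle) (hvlow l hl.le) (hv i l hl.ne')
    have hcd : cohDim (irrelevantQ K m n) (F i.succ) = ((q i : ℕ∞) : WithBot ℕ∞) :=
      cohDim_eq_of_vanishes (fun h => hq i (.right (Submodule.inclusion_injective hle)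
        (Submodule.mkQ_surjective _) (submoduleOf_inclusion_exact hle) h
        (hvlow _ (Nat.le_succ _)))) hvup
    have hlow {p : Ideal (BigradedPoly K m n)} (hp : p.IsPrime)
        (hcdp : ∃ j, q i ≤ j ∧ ¬ LocCohomVanishes (irrelevantQ K m n) j (BigradedPoly K m n ⧸ p)) :
        ¬ Module.annihilator (BigradedPoly K m n) (F i.castSucc) ≤ p := by
      intro hann
      obtain ⟨j, hj, hnv⟩ := hcdp
      exact hnv (.quotient_prime (d := n) (fun l hl N => irrelevantQ_localCohomologyVanishes hl N)
        (F i.castSucc) (q i) hvlow hp hann hj)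
    ext p
    constructor
    · intro hp
      obtain ⟨j, hj, hnv⟩ := exists_not_vanishes_of_isAssociatedPrime
        (hF.isHomogeneous i.castSucc) (fun j hj => hv i j hj.ne) hp
      have hvp (l : ℕ) (hl : q i + 1 ≤ l) :
          LocCohomVanishes (irrelevantQ K m n) l (BigradedPoly K m n ⧸ p) :=
        .quotient_prime (d := n) (fun l hl N => irrelevantQ_localCohomologyVanishes hl N)
          (FiltQuot F i) (q i + 1) (fun l hl => hv i l (by lia)) hp.isPrime
          (Submodule.annihilator_top.symm.le.trans hp.annihilator_le) hl
      -- Fact (b) bounds cd(S/p) below by `q i`; `hvp`, the support bound for the quotient itself,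
      -- bounds it above.
      obtain rfl : j = q i := by
        by_contra hne
        exact hnv (hvp j (by lia))
      refine ⟨hp.of_quotient fun h => hlow hp.isPrime ⟨q i, le_rfl, hnv⟩ (le_trans ?_ h), ?_⟩
      · intro a ha
        refine Submodule.mem_annihilator.2 fun x hx => ?_
        have h : a • (⟨x, hx⟩ : F i.castSucc) = 0 := Module.mem_annihilator.1 ha ⟨x, hx⟩
        exact Subtype.ext (congrArg (Subtype.val : F i.castSucc → M) h)
      · rw [hcd]
        exact cohDim_eq_of_vanishes hnv hvp
    · rintro ⟨hp, hpcd⟩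
      rw [hcd] at hpcd
      -- p is associated to M_{i-1} or to M_i/M_{i-1}; the first would force cd(S/p) < `q i`.
      refine (associatedPrimes.subset_union_of_exact (Submodule.inclusion_injective hle)
        (submoduleOf_inclusion_exact hle) hp).resolve_left fun hp' => ?_
      exact hlow hp.isPrime (exists_not_vanishes_of_le_cohDim hpcd.ge)
        (Submodule.annihilator_top.symm.le.trans hp'.annihilator_le)
  refine ⟨hmain, ?_⟩
  rw [hmain]
  exact ⟨fun h p hp => ((Set.ext_iff.1 h p).2 hp).2.symm,
    fun h => Set.ext fun p => ⟨fun hp => hp.1, fun hp => ⟨hp, (h p hp).symm⟩⟩⟩
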